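/- All manifolds are smooth, finite-dimensional, Hausdorff and second countable, and vector bundles are smooth of finite rank. \textbf{Infinitesimal ideal systems.} Let $A\to M$ be a Lie algebroid with anchor $\rho$ and bracket $[\cdot,\cdot]$. An \emph{infinitesimal ideal system} $(F_M,J,\nabla)$ in $A$ consists of an involutive subbundle $F_M\subseteq TM$, a subbundle $J\subseteq A$ with $\rho(J)\subseteq F_M$, and a flat $F_M$-connection $\nabla\colon\Gamma(F_M)\times\Gamma(A/J)\to\Gamma(A/J)$ such that, for all local sections $a,b$ of $A$ and $j$ of $J$, writing $\bar a$ for the class of $a$ in $A/J$: (1) if $\bar a$ is $\nabla$-parallel, then $[a,j]$ is a section of $J$; (2) if $\bar a$ and $\bar b$ are $\nabla$-parallel, then $\overline{[a,b]}$ is $\nabla$-parallel; (3) if $\bar a$ is $\nabla$-parallel, then $\overline{\rho(a)}\in\Gamma(TM/F_M)$ is parallel for the Bott connection $\nabla^{F_M}_Y\bar X=\overline{[Y,X]}$ of $F_M$. \textbf{The quotient.} The \emph{quotient Lie algebroid} $(A/J)/\nabla\to M/F_M$ \emph{exists} if the leaf space is a smooth manifold and the quotient of $A/J$ by $\nabla$-parallel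 transport is a Lie algebroid over it, that is, if there are a Lie algebroid $A'\to M'$ and a Lie algebroid morphism $\pi\colon A\to A'$ over a smooth surjective submersion $\pi_M\colon M\to M'$ such that $\ker T\pi_M=F_M$, the fibres of $\pi_M$ are the leaves of $F_M$, $\pi$ is fibrewise surjective, and for $a\in A_x$, $b\in A_y$ one has $\pi(a)=\pi(b)$ if and only if $x$ and $y$ lie in the same leaf of $F_M$ and some $\nabla$-parallel section of $A/J$ passes through both $\bar a$ and $\bar b$. \textbf{The Atiyah class.} An \emph{extension} of $\nabla$ is a linear connection $D\colon\mathfrak X(M)\times\Gamma(A)\to\Gamma(A)$ that preserves $\Gamma(J)$ and whose induced connection on $A/J$ restricts to $\nabla$ on $\Gamma(F_M)$. With $R_D$ the curvature of $D$, \[\omega_D(Y)(\bar X)(\bar a)=\overline{R_D(Y,X)a},\qquad Y\in\Gamma(F_M),\ X\in\mathfrak X(M),\ a\in\Gamma(A),\] is a well-defined form $\omega_D\in\Omega^1(F_M,\operatorname{Hom}(TM/F_M,\operatorname{End}(A/J)))$. It is closed for the differential defined by the flat $F_M$-connection on $\operatorname{Hom}(TM/F_M,\operatorname{End}(A/J))$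 that $\nabla$ and the Bott connection induce. The \emph{Atiyah class} of $(F_M,J,\nabla)$ is \[\alpha_\nabla=[\omega_D]\in H^1(F_M,\operatorname{Hom}(TM/F_M,\operatorname{End}(A/J))).\] \textbf{Proposition.} Let $(F_M,J,\nabla)$ be an infinitesimal ideal system in a Lie algebroid $A\to M$. If the quotient Lie algebroid $(A/J)/\nabla\to M/F_M$ exists, then the Atiyah class \[\alpha_\nabla\in H^1(F_M,\operatorname{Hom}(TM/F_M,\operatorname{End}(A/J)))\] of the ideal vanishes; that is, extensions of $\nabla$ exist, and $[\omega_D]=0$ for every extension $D$ of $\nabla$. -/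

import Mathlib

/-! ## Connections over Lie-Rinehart rings and their de Rham complex -/

/-- A linear `L`-connection on the `R`-module `V`, where `(R, L)` is a Lie-Rinehart ring. For
`R = C^∞(M)`, `L` the sections of a subbundle of `TM` and `V` the sections of a vector bundle this
is the usual notion of a (partial) linear connection. -/
structure LinearConnection (R L V : Type*) [CommRing R] [LieRing L] [Module R L]
    [LieRingModule L R] [AddCommGroup V] [Module R V] where
  /-- `∇_X v` -/
  toFun : L → V → V
  add_left : ∀ X Y v, toFun (X + Y) v = toFun X v + toFun Y v
  smul_left : ∀ (f : R) X v, toFun (f • X) v = f • toFun X v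
  add_right : ∀ X v w, toFun X (v + w) = toFun X v + toFun X w
  leibniz : ∀ X (f : R) v, toFun X (f • v) = f • toFun X v + ⁅X, f⁆ • v

namespace LinearConnection

section basic

variable {R L V W : Type*} [CommRing R] [LieRing L] [Module R L] [LieRingModule L R]
  [AddCommGroup V] [Module R V] [AddCommGroup W] [Module R W]

instance : CoeFun (LinearConnection R L V) (fun _ => L → V → V) := ⟨toFun⟩

variable (D : LinearConnection R L V) (D' : LinearConnection R L W)

theorem map_zero_right (X : L) : D X 0 = 0 := by
  have h := D.add_right X 0 0
  simpa using h

theorem map_neg_right (X : L) (v : V) : D X (-v) = -D X v := by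
  have h := D.add_right X v (-v)
  rw [add_neg_cancel, D.map_zero_right] at h
  exact (neg_eq_of_add_eq_zero_right h.symm).symm

theorem map_sub_right (X : L) (v w : V) : D X (v - w) = D X v - D X w := by
  rw [sub_eq_add_neg, D.add_right, D.map_neg_right, sub_eq_add_neg]

theorem map_zero_left (v : V) : D 0 v = 0 := by
  have h := D.add_left 0 0 v
  simpa using h

theorem map_neg_left (X : L) (v : V) : D (-X) v = -D X v := by
  have h := D.add_left X (-X) v
  rw [add_neg_cancel, D.map_zero_left] at h
  exact (neg_eq_of_add_eq_zero_right h.symm).symm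

theorem map_sub_left (X Y : L) (v : V) : D (X - Y) v = D X v - D Y v := by
  rw [sub_eq_add_neg, D.add_left, D.map_neg_left, sub_eq_add_neg]

/-- `∇ ↦ (v ↦ ∇_• v)`, that is, the differential `Ω⁰(L, V) → Ω¹(L, V)`. -/
def d₀ : V →+ (L →ₗ[R] V) where
  toFun v :=
    { toFun := fun X => D X v
      map_add' := fun X Y => D.add_left X Y v
      map_smul' := fun f X => D.smul_left f X v }
  map_zero' := by ext X; exact D.map_zero_right X
  map_add' v w := by ext X; exact D.add_right X v w

@[simp] theorem d₀_apply (v : V) (X : L) : D.d₀ v X = D X v := rfl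

/-- The induced connection on `Hom(V, W)`: `(∇_X φ)(v) = ∇_X(φ(v)) - φ(∇_X v)`. -/
def hom : LinearConnection R L (V →ₗ[R] W) where
  toFun X φ :=
    { toFun := fun v => D' X (φ v) - φ (D X v)
      map_add' := fun v w => by
        simp only [map_add, D.add_right, D'.add_right]; abel
      map_smul' := fun f v => by
        simp only [map_smul, map_add, D.leibniz, D'.leibniz, RingHom.id_apply, smul_sub]; abel }
  add_left X Y φ := by
    ext v
    simp only [LinearMap.coe_mk, AddHom.coe_mk, LinearMap.add_apply, D.add_left, D'.add_left,
      map_add]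
    abel
  smul_left f X φ := by
    ext v
    simp only [LinearMap.coe_mk, AddHom.coe_mk, LinearMap.smul_apply, D.smul_left, D'.smul_left,
      map_smul, smul_sub]
  add_right X φ ψ := by
    ext v
    simp only [LinearMap.coe_mk, AddHom.coe_mk, LinearMap.add_apply, D'.add_right]
    abel
  leibniz X f φ := by
    ext v
    simp only [LinearMap.coe_mk, AddHom.coe_mk, LinearMap.add_apply, LinearMap.smul_apply,
      D'.leibniz, smul_sub]
    abel

@[simp] theorem hom_apply (X : L) (φ : V →ₗ[R] W) (v : V) :
    D.hom D' X φ v = D' X (φ v) - φ (D X v) := rfl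

/-- A connection on `V` preserving the submodule `N` induces a connection on `V ⧸ N`. -/
def quotient (N : Submodule R V) (hN : ∀ X, ∀ v ∈ N, D X v ∈ N) :
    LinearConnection R L (V ⧸ N) where
  toFun X := QuotientAddGroup.map N.toAddSubgroup N.toAddSubgroup
    (AddMonoidHom.mk' (D X) (D.add_right X)) (hN X)
  add_left X Y v := by
    induction v using Submodule.Quotient.induction_on with
    | _ v => exact congrArg (Submodule.Quotient.mk (p := N)) (D.add_left X Y v)
  smul_left f X v := by
    induction v using Submodule.Quotient.induction_on with
    | _ v => exact congrArg (Submodule.Quotient.mk (p := N)) (D.smul_left f X v)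
  add_right X v w := map_add _ v w
  leibniz X f v := by
    induction v using Submodule.Quotient.induction_on with
    | _ v => exact congrArg (Submodule.Quotient.mk (p := N)) (D.leibniz X f v)

@[simp] theorem quotient_mk (N : Submodule R V) (hN : ∀ X, ∀ v ∈ N, D X v ∈ N) (X : L) (v : V) :
    D.quotient N hN X (Submodule.Quotient.mk v) = Submodule.Quotient.mk (D X v) := rfl

/-- The restriction of an `L`-connection to a Lie-Rinehart subalgebra of `L`. -/
def restrict (K : LieRinehartSubalgebra R L) : LinearConnection R K V where
  toFun Y v := D (Y : L) v
  add_left X Y v := D.add_left X Y v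
  smul_left f X v := D.smul_left f X v
  add_right X v w := D.add_right X v w
  leibniz X f v := D.leibniz X f v

@[simp] theorem restrict_apply (K : LieRinehartSubalgebra R L) (Y : K) (v : V) :
    D.restrict K Y v = D (Y : L) v := rfl

/-- Vanishing curvature: `∇_X ∇_Y - ∇_Y ∇_X - ∇_[X,Y] = 0`. -/
def IsFlat : Prop := ∀ X Y v, D X (D Y v) - D Y (D X v) - D ⁅X, Y⁆ v = 0

variable {D D'} in
theorem IsFlat.lie_apply (hD : D.IsFlat) (X Y : L) (v : V) :
    D ⁅X, Y⁆ v = D X (D Y v) - D Y (D X v) := (sub_eq_zero.1 (hD X Y v)).symm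

variable {D D'} in
theorem IsFlat.hom (hD : D.IsFlat) (hD' : D'.IsFlat) : (D.hom D').IsFlat := by
  intro X Y φ
  ext v
  simp only [LinearMap.sub_apply, hom_apply, hD.lie_apply, hD'.lie_apply, map_sub,
    D'.map_sub_right, LinearMap.zero_apply]
  abel

end basic

section LieRinehart

variable {R L V : Type*} [CommRing R] [LieRing L] [Module R L] [LieRingModule L R]
  [LieRinehartRing R L] [AddCommGroup V] [Module R V] (D : LinearConnection R L V)

theorem smul_lie' (f : R) (X Y : L) : ⁅f • X, Y⁆ = f • ⁅X, Y⁆ - ⁅Y, f⁆ • X := by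
  rw [← lie_skew, LieRinehartRing.leibniz_smul_right, neg_add, ← smul_neg, lie_skew,
    sub_eq_add_neg]

/-- The curvature `R(X, Y)v = ∇_X ∇_Y v - ∇_Y ∇_X v - ∇_[X,Y] v`, as an `R`-trilinear map. -/
def curvature : L →ₗ[R] L →ₗ[R] V →ₗ[R] V :=
  LinearMap.mk₂ R
    (fun X Y =>
      { toFun := fun v => D X (D Y v) - D Y (D X v) - D ⁅X, Y⁆ v
        map_add' := fun v w => by
          simp only [D.add_right]; abel
        map_smul' := fun f v => by
          simp only [D.leibniz, D.add_right, RingHom.id_apply, smul_sub, lie_lie, sub_smul]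
          abel })
    (fun X X' Y => by
      ext v
      simp only [LinearMap.coe_mk, AddHom.coe_mk, LinearMap.add_apply, D.add_left, D.add_right,
        add_lie]
      abel)
    (fun f X Y => by
      ext v
      simp only [LinearMap.coe_mk, AddHom.coe_mk, LinearMap.smul_apply, D.smul_left, D.leibniz,
        smul_lie', D.map_sub_left, smul_sub]
      abel)
    (fun X Y Y' => by
      ext v
      simp only [LinearMap.coe_mk, AddHom.coe_mk, LinearMap.add_apply, D.add_left, D.add_right,
        lie_add]
      abel)
    (fun f X Y => by
      ext v
      simp only [LinearMap.coe_mk, AddHom.coe_mk, LinearMap.smul_apply, D.smul_left, D.leibniz,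
        LieRinehartRing.leibniz_smul_right, D.add_left, smul_sub]
      abel)

@[simp] theorem curvature_apply (X Y : L) (v : V) :
    D.curvature X Y v = D X (D Y v) - D Y (D X v) - D ⁅X, Y⁆ v := rfl

/-- The exterior covariant derivative `Ω¹(L, V) → Ω²(L, V)`,
`(dω)(X, Y) = ∇_X(ω(Y)) - ∇_Y(ω(X)) - ω([X, Y])`. The values are alternating bilinear maps; they
are recorded as bilinear maps, which does not change the kernel. -/
def d₁ : (L →ₗ[R] V) →+ (L →ₗ[R] L →ₗ[R] V) where
  toFun ω := LinearMap.mk₂ R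
    (fun X Y => D X (ω Y) - D Y (ω X) - ω ⁅X, Y⁆)
    (fun X X' Y => by simp only [D.add_left, D.add_right, map_add, add_lie]; abel)
    (fun f X Y => by
      simp only [D.smul_left, D.leibniz, map_smul, smul_lie', map_sub, smul_sub]; abel)
    (fun X Y Y' => by simp only [D.add_left, D.add_right, map_add, lie_add]; abel)
    (fun f X Y => by
      simp only [D.smul_left, D.leibniz, map_smul, LieRinehartRing.leibniz_smul_right, map_add,
        smul_sub]
      abel)
  map_zero' := by
    ext X Y
    simp [D.map_zero_right]
  map_add' ω η := by
    ext X Y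
    simp only [LinearMap.mk₂_apply, LinearMap.add_apply, D.add_right]
    abel

@[simp] theorem d₁_apply (ω : L →ₗ[R] V) (X Y : L) :
    D.d₁ ω X Y = D X (ω Y) - D Y (ω X) - ω ⁅X, Y⁆ := rfl

variable {D} in
theorem IsFlat.d₁_d₀ (hD : D.IsFlat) (v : V) : D.d₁ (D.d₀ v) = 0 := by
  ext X Y
  exact hD X Y v

/-- The first cohomology group `H¹(L, V)` of a (flat) connection: closed 1-forms modulo exact
ones. -/
abbrev H1 : Type _ := D.d₁.ker ⧸ (D.d₀.range.addSubgroupOf D.d₁.ker)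

end LieRinehart

section BottAtiyah

variable {R L : Type*} [CommRing R] [LieRing L] [Module R L] [LieRingModule L R]
  [LieRinehartRing R L] (K : LieRinehartSubalgebra R L)

/-- The Bott connection of `K` on `L ⧸ K`, `∇_Y X̄ = class of [Y, X]`. -/
def bott : LinearConnection R K (L ⧸ K.toSubmodule) where
  toFun Y := QuotientAddGroup.map K.toSubmodule.toAddSubgroup K.toSubmodule.toAddSubgroup
    (AddMonoidHom.mk' (fun X : L => ⁅(Y : L), X⁆) (lie_add (Y : L)))
    (fun _ hX => K.lie_mem Y.2 hX)
  add_left X Y v := by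
    induction v using Submodule.Quotient.induction_on with
    | _ v => exact congrArg (Submodule.Quotient.mk (p := K.toSubmodule)) (add_lie (X : L) Y v)
  smul_left f X v := by
    induction v using Submodule.Quotient.induction_on with
    | _ v =>
      refine (Submodule.Quotient.eq K.toSubmodule).2 ?_
      change ⁅f • (X : L), v⁆ - f • ⁅(X : L), v⁆ ∈ K.toSubmodule
      rw [smul_lie', sub_sub_cancel_left]
      exact K.toSubmodule.neg_mem (K.toSubmodule.smul_mem _ X.2)
  add_right X v w := map_add _ v w
  leibniz X f v := by
    induction v using Submodule.Quotient.induction_on with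
    | _ v =>
      exact congrArg (Submodule.Quotient.mk (p := K.toSubmodule))
        (LieRinehartRing.leibniz_smul_right (X : L) v f)

@[simp] theorem bott_mk (Y : K) (X : L) :
    bott K Y (Submodule.Quotient.mk X) = Submodule.Quotient.mk ⁅(Y : L), X⁆ := rfl

theorem isFlat_bott : (bott K).IsFlat := by
  intro X Y v
  induction v using Submodule.Quotient.induction_on with
  | _ v =>
    simp only [bott_mk, ← Submodule.Quotient.mk_sub, LieRinehartSubalgebra.coe_bracket, lie_lie,
      sub_self]

variable {Q : Type*} [AddCommGroup Q] [Module R Q]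

/-- For a flat `K`-connection `∇` on `Q`, the induced `K`-connection on `Hom(L ⧸ K, End Q)`:
`(∇_Y φ)(X̄)(q) = ∇_Y(φ(X̄)(q)) - φ(X̄)(∇_Y q) - φ(∇^Bott_Y X̄)(q)`. -/
def bottHom {K : LieRinehartSubalgebra R L} (P : LinearConnection R K Q) :
    LinearConnection R K ((L ⧸ K.toSubmodule) →ₗ[R] Q →ₗ[R] Q) :=
  (bott K).hom (P.hom P)

variable (D : LinearConnection R L Q)

/-- For an `L`-connection on `Q` that is flat on `K`, the `K`-form with values in
`Hom(L ⧸ K, End Q)` given by `ω(Y)(X̄)(q) = R(Y, X)q`. -/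
def curvatureForm (hD : (D.restrict K).IsFlat) :
    K →ₗ[R] (L ⧸ K.toSubmodule) →ₗ[R] Q →ₗ[R] Q where
  toFun Y := K.toSubmodule.liftQ (D.curvature (Y : L)) fun X hX => by
    ext q
    exact hD Y ⟨X, hX⟩ q
  map_add' Y Y' := by
    ext X q
    exact congrArg (fun T => T X q) (map_add D.curvature (Y : L) (Y' : L))
  map_smul' f Y := by
    ext X q
    exact congrArg (fun T => T X q) (map_smul D.curvature f (Y : L))

@[simp] theorem curvatureForm_mk (hD : (D.restrict K).IsFlat) (Y : K) (X : L) (q : Q) :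
    D.curvatureForm K hD Y (Submodule.Quotient.mk X) q = D.curvature (Y : L) X q := rfl

theorem d₁_curvatureForm (hD : (D.restrict K).IsFlat) :
    (bottHom (D.restrict K)).d₁ (D.curvatureForm K hD) = 0 := by
  have key : ∀ (Y Z : K) (q : Q), D ⁅(Y : L), (Z : L)⁆ q = D Y (D Z q) - D Z (D Y q) :=
    fun Y Z q => hD.lie_apply Y Z q
  ext Y Z X q
  have jac : ∀ q, D ⁅⁅(Y : L), (Z : L)⁆, X⁆ q
      = D ⁅(Y : L), ⁅(Z : L), X⁆⁆ q - D ⁅(Z : L), ⁅(Y : L), X⁆⁆ q := fun q => by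
    rw [lie_lie, D.map_sub_left]
  simp only [d₁_apply, bottHom, LinearMap.sub_apply, hom_apply, LinearMap.comp_apply,
    Submodule.mkQ_apply, bott_mk, curvatureForm_mk, curvature_apply, restrict_apply,
    LieRinehartSubalgebra.coe_bracket, D.map_sub_right, jac, key, LinearMap.zero_apply]
  abel

end BottAtiyah

end LinearConnection
/-! ## Smooth functions, sections and vector fields -/

open Bundle Manifold
open scoped ContDiff Topology

noncomputable section Sections

/-- The ring `C^∞(M)`. -/
abbrev SmoothFn (E M : Type*) [NormedAddCommGroup E] [NormedSpace ℝ E] [TopologicalSpace M]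
    [ChartedSpace E M] : Type _ :=
  ContMDiffMap 𝓘(ℝ, E) 𝓘(ℝ) M ℝ ∞

/-- The space `Γ(A)` of smooth sections of a vector bundle `A → M` with typical fibre `F`. -/
abbrev SmoothSec (E F : Type*) {M : Type*} [NormedAddCommGroup E] [NormedSpace ℝ E]
    [TopologicalSpace M] [ChartedSpace E M] [NormedAddCommGroup F] [NormedSpace ℝ F]
    (A : M → Type*) [TopologicalSpace (TotalSpace F A)] [∀ x, TopologicalSpace (A x)]
    [FiberBundle F A] : Type _ :=
  ContMDiffSection 𝓘(ℝ, E) F ∞ A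

/-- The space `𝔛(M)` of smooth vector fields. -/
abbrev SmoothVF (E M : Type*) [NormedAddCommGroup E] [NormedSpace ℝ E] [TopologicalSpace M]
    [ChartedSpace E M] [IsManifold 𝓘(ℝ, E) ∞ M] : Type _ :=
  SmoothSec E E (fun x : M => TangentSpace 𝓘(ℝ, E) x)

variable {E M F : Type*} [NormedAddCommGroup E] [NormedSpace ℝ E]
  [TopologicalSpace M] [ChartedSpace E M] [NormedAddCommGroup F] [NormedSpace ℝ F]
  {A : M → Type*} [TopologicalSpace (TotalSpace F A)] [∀ x, AddCommGroup (A x)]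
  [∀ x, Module ℝ (A x)] [∀ x, TopologicalSpace (A x)] [FiberBundle F A] [VectorBundle ℝ F A]

namespace SmoothSec

instance instSMulFn : SMul (SmoothFn E M) (SmoothSec E F A) :=
  ⟨fun f s => ⟨(f : M → ℝ) • (s : ∀ x, A x), f.contMDiff.smul_section s.contMDiff⟩⟩

@[simp] theorem smul_fn_apply (f : SmoothFn E M) (s : SmoothSec E F A) (x : M) :
    (f • s) x = f x • s x := rfl

instance instModuleFn : Module (SmoothFn E M) (SmoothSec E F A) where
  one_smul s := by ext x; exact one_smul ℝ (s x)
  mul_smul f g s := by ext x; exact mul_smul (f x) (g x) (s x)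
  smul_zero f := by ext x; exact smul_zero (f x)
  smul_add f s t := by ext x; exact smul_add (f x) (s x) (t x)
  add_smul f g s := by ext x; exact add_smul (f x) (g x) (s x)
  zero_smul s := by ext x; exact zero_smul ℝ (s x)

/-- Evaluation of sections at `x`, semilinear over the evaluation `C^∞(M) → ℝ`. -/
def evalAt (x : M) :
    SmoothSec E F A →ₛₗ[(ContMDiffMap.evalRingHom x : SmoothFn E M →+* ℝ)] A x where
  toFun s := s x
  map_add' _ _ := rfl
  map_smul' _ _ := rfl

end SmoothSec

namespace SmoothVF

variable [IsManifold 𝓘(ℝ, E) ∞ M]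

instance isManifold_infty_succ : IsManifold 𝓘(ℝ, E) (((⊤ : ℕ∞) : ℕ∞ω) + 1) M :=
  IsManifold.of_le (n := ∞) (by exact le_rfl)

instance isManifold_minSmoothness_two : IsManifold 𝓘(ℝ, E) (minSmoothness ℝ 2) M :=
  IsManifold.of_le (n := ∞) (by
    rw [minSmoothness_of_isRCLikeNormedField]; exact (ENat.LEInfty.out : (2 : ℕ∞ω) ≤ ∞))

instance isManifold_minSmoothness_three : IsManifold 𝓘(ℝ, E) (minSmoothness ℝ 3) M :=
  IsManifold.of_le (n := ∞) (by
    rw [minSmoothness_of_isRCLikeNormedField]; exact (ENat.LEInfty.out : (3 : ℕ∞ω) ≤ ∞))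

theorem two_le_infty : minSmoothness ℝ 2 ≤ (∞ : ℕ∞ω) := by
  rw [minSmoothness_of_isRCLikeNormedField]; exact ENat.LEInfty.out

theorem mdiffAt (X : SmoothVF E M) (x : M) :
    MDifferentiableAt 𝓘(ℝ, E) 𝓘(ℝ, E).tangent (fun y => (⟨y, X y⟩ : TangentBundle 𝓘(ℝ, E) M)) x :=
  X.contMDiff.mdifferentiable (by simp) x

/-- The derivative `X f = df(X)` of a smooth function along a vector field. -/
instance instBracketFn : Bracket (SmoothVF E M) (SmoothFn E M) :=
  ⟨fun X f => ⟨fun x => mvfderiv 𝓘(ℝ, E) f x (X x), by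
    have h := ((contMDiff_snd_tangentBundle_modelSpace ℝ 𝓘(ℝ)).comp
      (f.contMDiff.contMDiff_tangentMap (m := ∞) (by simp))).comp X.contMDiff
    exact h⟩⟩

theorem lie_fn_apply (X : SmoothVF E M) (f : SmoothFn E M) (x : M) :
    ⁅X, f⁆ x = mvfderiv 𝓘(ℝ, E) f x (X x) := rfl

variable [FiniteDimensional ℝ E]

instance instBracket : Bracket (SmoothVF E M) (SmoothVF E M) :=
  ⟨fun X Y => ⟨VectorField.mlieBracket 𝓘(ℝ, E) X Y, by
    have := FiniteDimensional.complete ℝ E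
    exact ContDiff.mlieBracket_vectorField (m := ⊤) (n := ⊤) X.contMDiff Y.contMDiff
      (by simp)⟩⟩

theorem lie_coe (X Y : SmoothVF E M) :
    (⁅X, Y⁆ : SmoothVF E M) = VectorField.mlieBracket 𝓘(ℝ, E) (fun x => X x) (fun x => Y x) := rfl

theorem lie_apply (X Y : SmoothVF E M) (x : M) :
    (⁅X, Y⁆ : SmoothVF E M) x
      = VectorField.mlieBracket 𝓘(ℝ, E) (fun x => X x) (fun x => Y x) x := rfl

instance instLieRing : LieRing (SmoothVF E M) where
  add_lie X Y Z := by
    ext x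
    exact VectorField.mlieBracket_add_left (X.mdiffAt x) (Y.mdiffAt x)
  lie_add X Y Z := by
    ext x
    exact VectorField.mlieBracket_add_right (Y.mdiffAt x) (Z.mdiffAt x)
  lie_self X := by
    ext x
    exact congrFun VectorField.mlieBracket_self x
  leibniz_lie X Y Z := by
    have := FiniteDimensional.complete ℝ E
    ext x
    have h : ∀ X : SmoothVF E M, ContMDiffAt 𝓘(ℝ, E) 𝓘(ℝ, E).tangent (minSmoothness ℝ 2)
        (fun y => (⟨y, X y⟩ : TangentBundle 𝓘(ℝ, E) M)) x := fun X =>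
      (X.contMDiff x).of_le two_le_infty
    exact VectorField.leibniz_identity_mlieBracket_apply (h X) (h Y) (h Z)

theorem lie_smul_apply (X : SmoothVF E M) (f : SmoothFn E M)
    (Y : ∀ x : M, TangentSpace 𝓘(ℝ, E) x) (x : M)
    (hY : MDifferentiableAt 𝓘(ℝ, E) 𝓘(ℝ, E).tangent
      (fun y => (⟨y, Y y⟩ : TangentBundle 𝓘(ℝ, E) M)) x) :
    VectorField.mlieBracket 𝓘(ℝ, E) X ((f : M → ℝ) • Y) x
      = ⁅X, f⁆ x • Y x + f x • VectorField.mlieBracket 𝓘(ℝ, E) X Y x :=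
  VectorField.mlieBracket_smul_right (f.contMDiff.mdifferentiable (by simp) x) hY

theorem leibniz_fn_aux {W : Type*} [AddCommGroup W] [Module ℝ W] {a b c d e g : ℝ} {v p q r s : W}
    (h : a • v + d • p + (e • q + g • (r + s)) = b • v + g • r + (c • v + e • q + (d • p + g • s))) :
    (a - (b + c)) • v = 0 := by
  linear_combination (norm := module) (1 : ℝ) • h

theorem leibniz_fn (X Y : SmoothVF E M) (f : SmoothFn E M) : 
    ⁅X, ⁅Y, f⁆⁆ = ⁅⁅X, Y⁆, f⁆ + ⁅Y, ⁅X, f⁆⁆ := by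
  have hE := FiniteDimensional.complete ℝ E
  ext x
  rcases subsingleton_or_nontrivial E with hs | hn
  · have h0 : ∀ (X : SmoothVF E M) (g : SmoothFn E M), ⁅X, g⁆ x = 0 := fun X g => by
      have : X x = 0 := Subsingleton.elim (α := E) _ _
      rw [lie_fn_apply, this, map_zero]
    change ⁅X, ⁅Y, f⁆⁆ x = ⁅⁅X, Y⁆, f⁆ x + ⁅Y, ⁅X, f⁆⁆ x
    simp only [h0, add_zero]
  obtain ⟨v, hv⟩ := exists_ne (0 : E)
  let Z : ∀ y : M, TangentSpace 𝓘(ℝ, E) y :=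
    FiberBundle.extend E (E := fun y : M => TangentSpace 𝓘(ℝ, E) y)
      (x := x) (v : TangentSpace 𝓘(ℝ, E) x)
  have hZx : Z x = v := FiberBundle.extend_apply_self E (E := fun y : M => TangentSpace 𝓘(ℝ, E) y)
      (x := x) (v : TangentSpace 𝓘(ℝ, E) x)
  have hZ : ContMDiffAt 𝓘(ℝ, E) 𝓘(ℝ, E).tangent ∞
      (fun y => (⟨y, Z y⟩ : TangentBundle 𝓘(ℝ, E) M)) x :=
    FiberBundle.contMDiffAt_extend 𝓘(ℝ, E) E _
  have hZn : ∀ᶠ y in 𝓝 x, MDifferentiableAt 𝓘(ℝ, E) 𝓘(ℝ, E).tangent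
      (fun y => (⟨y, Z y⟩ : TangentBundle 𝓘(ℝ, E) M)) y := by
    have h1 := ContMDiffAt.of_le hZ (ENat.LEInfty.out : (1 : ℕ∞ω) ≤ ∞)
    filter_upwards [(contMDiffAt_iff_contMDiffAt_nhds (by simp)).1 h1] with y hy
    exact ContMDiffAt.mdifferentiableAt hy (one_ne_zero)
  have sm : ∀ (g : SmoothFn E M) {W : ∀ y : M, TangentSpace 𝓘(ℝ, E) y},
      ContMDiffAt 𝓘(ℝ, E) 𝓘(ℝ, E).tangent ∞
        (fun y => (⟨y, W y⟩ : TangentBundle 𝓘(ℝ, E) M)) x →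
      ContMDiffAt 𝓘(ℝ, E) 𝓘(ℝ, E).tangent ∞
        (fun y => (⟨y, ((g : M → ℝ) • W) y⟩ : TangentBundle 𝓘(ℝ, E) M)) x :=
    fun g W hW => ContMDiffAt.smul_section (g.contMDiff x) hW
  have br : ∀ X : SmoothVF E M, ContMDiffAt 𝓘(ℝ, E) 𝓘(ℝ, E).tangent ∞
      (fun y => (⟨y, VectorField.mlieBracket 𝓘(ℝ, E) X Z y⟩ : TangentBundle 𝓘(ℝ, E) M)) x :=
    fun X => ContMDiffAt.mlieBracket_vectorField (m := ⊤) (n := ⊤) (X.contMDiff x) hZ (by simp)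
  have md : ∀ {W : ∀ y : M, TangentSpace 𝓘(ℝ, E) y},
      ContMDiffAt 𝓘(ℝ, E) 𝓘(ℝ, E).tangent ∞
        (fun y => (⟨y, W y⟩ : TangentBundle 𝓘(ℝ, E) M)) x →
      MDifferentiableAt 𝓘(ℝ, E) 𝓘(ℝ, E).tangent
        (fun y => (⟨y, W y⟩ : TangentBundle 𝓘(ℝ, E) M)) x := fun h =>
    h.mdifferentiableAt (by simp)
  have exp : ∀ X Y : SmoothVF E M,
      VectorField.mlieBracket 𝓘(ℝ, E) X (VectorField.mlieBracket 𝓘(ℝ, E) Y ((f : M → ℝ) • Z)) x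
        = (⁅X, ⁅Y, f⁆⁆ x • Z x + ⁅Y, f⁆ x • VectorField.mlieBracket 𝓘(ℝ, E) X Z x)
          + (⁅X, f⁆ x • VectorField.mlieBracket 𝓘(ℝ, E) Y Z x
            + f x • VectorField.mlieBracket 𝓘(ℝ, E) X
                (VectorField.mlieBracket 𝓘(ℝ, E) Y Z) x) := fun X Y => by
    have h1 : VectorField.mlieBracket 𝓘(ℝ, E) Y ((f : M → ℝ) • Z) =ᶠ[𝓝 x]
        ((⁅Y, f⁆ : SmoothFn E M) : M → ℝ) • Z
          + (f : M → ℝ) • VectorField.mlieBracket 𝓘(ℝ, E) Y Z := by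
      filter_upwards [hZn] with y hy
      exact lie_smul_apply Y f Z y hy
    refine (Filter.EventuallyEq.mlieBracket_vectorField_eq Filter.EventuallyEq.rfl h1).trans ?_
    rw [VectorField.mlieBracket_add_right (md (sm _ hZ)) (md (sm _ (br Y))),
      lie_smul_apply X _ Z x (md hZ), lie_smul_apply X f _ x (md (br Y))]
  have two : ∀ {W : ∀ y : M, TangentSpace 𝓘(ℝ, E) y},
      ContMDiffAt 𝓘(ℝ, E) 𝓘(ℝ, E).tangent ∞
        (fun y => (⟨y, W y⟩ : TangentBundle 𝓘(ℝ, E) M)) x →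
      ContMDiffAt 𝓘(ℝ, E) 𝓘(ℝ, E).tangent (minSmoothness ℝ 2)
        (fun y => (⟨y, W y⟩ : TangentBundle 𝓘(ℝ, E) M)) x := fun h => h.of_le two_le_infty
  have jac := VectorField.leibniz_identity_mlieBracket_apply (two (X.contMDiff x))
    (two (Y.contMDiff x)) (two (sm f hZ))
  have jac' := VectorField.leibniz_identity_mlieBracket_apply (two (X.contMDiff x))
    (two (Y.contMDiff x)) (two hZ)
  rw [exp X Y, exp Y X, ← lie_coe, lie_smul_apply ⁅X, Y⁆ f Z x (md hZ), jac', lie_coe, hZx] at jac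
  have e : (⁅X, ⁅Y, f⁆⁆ x - (⁅⁅X, Y⁆, f⁆ x + ⁅Y, ⁅X, f⁆⁆ x)) • (v : TangentSpace 𝓘(ℝ, E) x) = 0 :=
    leibniz_fn_aux (W := E) jac
  have := (smul_eq_zero (M := E)).1 e
  exact sub_eq_zero.1 (this.resolve_right hv)

instance instLieRingModule : LieRingModule (SmoothVF E M) (SmoothFn E M) where
  add_lie X Y f := by
    ext x
    exact map_add (mvfderiv 𝓘(ℝ, E) f x) (X x) (Y x)
  lie_add X f g := by
    ext x
    have := mvfderiv_add (I := 𝓘(ℝ, E)) (f.contMDiff.mdifferentiable (by simp) x)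
      (g.contMDiff.mdifferentiable (by simp) x)
    exact congrArg (fun T => T (X x)) this
  leibniz_lie X Y f := leibniz_fn X Y f

instance instLieRinehartRing : LieRinehartRing (SmoothFn E M) (SmoothVF E M) where
  lie_smul_eq_mul' f g X := by
    ext x
    exact map_smul (mvfderiv 𝓘(ℝ, E) g x) (f x) (X x)
  leibniz_mul_right' X f g := by
    ext x
    have := mvfderiv_mul (I := 𝓘(ℝ, E)) (f.contMDiff.mdifferentiable (by simp) x)
      (g.contMDiff.mdifferentiable (by simp) x)
    have h2 := congrArg (fun T => T (X x)) this
    refine h2.trans ?_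
    simp [lie_fn_apply]
    ring
  leibniz_smul_right' X Y f := by
    ext x
    rw [add_comm]
    exact lie_smul_apply X f Y x (Y.mdiffAt x)

end SmoothVF

end Sections

/-! ## Subbundles, Lie algebroids, infinitesimal ideal systems and their quotients -/

noncomputable section Geometry

/-- A smooth subbundle of `A → M`: a family of subspaces of the fibres that is locally spanned by
a smooth frame. -/
structure SmoothSubbundle (E F : Type*) {M : Type*} [NormedAddCommGroup E] [NormedSpace ℝ E]
    [TopologicalSpace M] [ChartedSpace E M] [NormedAddCommGroup F] [NormedSpace ℝ F]
    (A : M → Type*) [TopologicalSpace (TotalSpace F A)] [∀ x, AddCommGroup (A x)]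
    [∀ x, Module ℝ (A x)] [∀ x, TopologicalSpace (A x)] [FiberBundle F A]
    [VectorBundle ℝ F A] where
  fiber : ∀ x, Submodule ℝ (A x)
  exists_frame : ∀ x₀ : M, ∃ U : Set M, IsOpen U ∧ x₀ ∈ U ∧
    ∃ (n : ℕ) (s : Fin n → ∀ x, A x),
      (∀ i, ContMDiffOn 𝓘(ℝ, E) (𝓘(ℝ, E).prod 𝓘(ℝ, F)) ∞
        (fun x => TotalSpace.mk' F x (s i x)) U) ∧
      ∀ x ∈ U, LinearIndependent ℝ (fun i => s i x) ∧
        Submodule.span ℝ (Set.range fun i => s i x) = fiber x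

section

variable {E M F : Type*} [NormedAddCommGroup E] [NormedSpace ℝ E]
  [TopologicalSpace M] [ChartedSpace E M] [NormedAddCommGroup F] [NormedSpace ℝ F]
  {A : M → Type*} [TopologicalSpace (TotalSpace F A)] [∀ x, AddCommGroup (A x)]
  [∀ x, Module ℝ (A x)] [∀ x, TopologicalSpace (A x)] [FiberBundle F A] [VectorBundle ℝ F A]

namespace SmoothSubbundle

variable (J : SmoothSubbundle E F A)

/-- The `C^∞(M)`-module `Γ(J) ⊆ Γ(A)`. -/
def sections : Submodule (SmoothFn E M) (SmoothSec E F A) where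
  carrier := {s | ∀ x, s x ∈ J.fiber x}
  add_mem' hs ht x := (J.fiber x).add_mem (hs x) (ht x)
  zero_mem' x := (J.fiber x).zero_mem
  smul_mem' f _ hs x := (J.fiber x).smul_mem (f x) (hs x)

/-- The `C^∞(M)`-module of smooth sections of the quotient bundle `A/J`, realised as
`Γ(A)/Γ(J)`; see `evalQuot_injective` and `exists_evalQuot_eq`. -/
abbrev QuotSec : Type _ := SmoothSec E F A ⧸ J.sections

/-- The value in `A_x/J_x` of a section of `A/J`. -/
def evalQuot (x : M) :
    J.QuotSec →ₛₗ[(ContMDiffMap.evalRingHom x : SmoothFn E M →+* ℝ)] (A x ⧸ J.fiber x) :=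
  Submodule.mapQ J.sections (J.fiber x) (SmoothSec.evalAt x) (fun _ hs => hs x)

@[simp] theorem evalQuot_mk (x : M) (s : SmoothSec E F A) :
    J.evalQuot x (Submodule.Quotient.mk s) = Submodule.Quotient.mk (s x) := rfl

theorem evalQuot_injective (p q : J.QuotSec) (h : ∀ x, J.evalQuot x p = J.evalQuot x q) :
    p = q := by
  induction p using Submodule.Quotient.induction_on with
  | _ s =>
    induction q using Submodule.Quotient.induction_on with
    | _ t =>
      refine (Submodule.Quotient.eq J.sections).2 fun x => ?_
      exact (Submodule.Quotient.eq (J.fiber x)).1 (h x)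

/-- Every section of the bundle `A/J` that lifts locally to smooth sections of `A` comes from a
unique element of `Γ(A)/Γ(J)`. -/
theorem exists_evalQuot_eq [FiniteDimensional ℝ E] [IsManifold 𝓘(ℝ, E) ∞ M] [T2Space M]
    [SigmaCompactSpace M] (q : ∀ x, A x ⧸ J.fiber x)
    (hq : ∀ x₀ : M, ∃ U ∈ 𝓝 x₀, ∃ s : ∀ x, A x,
      ContMDiffOn 𝓘(ℝ, E) (𝓘(ℝ, E).prod 𝓘(ℝ, F)) ∞ (fun x => TotalSpace.mk' F x (s x)) U ∧
      ∀ x ∈ U, Submodule.Quotient.mk (s x) = q x) :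
    ∃ p : J.QuotSec, ∀ x, J.evalQuot x p = q x := by
  obtain ⟨s, hs⟩ := exists_contMDiffSection_forall_mem_convex_of_local 𝓘(ℝ, E) A
    (fun x => {v : A x | (J.fiber x).mkQ v = q x})
    (fun x => (convex_singleton (q x)).linear_preimage (J.fiber x).mkQ) hq
  exact ⟨Submodule.Quotient.mk s, hs⟩

end SmoothSubbundle

end

section Tangent

variable {E M : Type*} [NormedAddCommGroup E] [NormedSpace ℝ E] [FiniteDimensional ℝ E]
  [TopologicalSpace M] [ChartedSpace E M] [IsManifold 𝓘(ℝ, E) ∞ M]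

/-- A smooth subbundle of the tangent bundle. -/
abbrev TangentSubbundle (E M : Type*) [NormedAddCommGroup E] [NormedSpace ℝ E]
    [TopologicalSpace M] [ChartedSpace E M] [IsManifold 𝓘(ℝ, E) ∞ M] : Type _ :=
  SmoothSubbundle E E (fun x : M => TangentSpace 𝓘(ℝ, E) x)

namespace SmoothSubbundle

/-- `F_M ⊆ TM` is involutive: `Γ(F_M)` is closed under the Lie bracket. -/
def IsInvolutive (FM : TangentSubbundle E M) : Prop :=
  ∀ X Y : SmoothVF E M, X ∈ FM.sections → Y ∈ FM.sections → ⁅X, Y⁆ ∈ FM.sections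

/-- `Γ(F_M)` as a Lie-Rinehart subalgebra of `𝔛(M)`, for `F_M` involutive. -/
abbrev lieSections (FM : TangentSubbundle E M) (h : FM.IsInvolutive) :
    LieRinehartSubalgebra (SmoothFn E M) (SmoothVF E M) where
  toSubmodule := FM.sections
  lie_mem' hX hY := h _ _ hX hY

/-- `x` and `y` lie in the same leaf of `F_M`: they are joined by a smooth curve tangent to
`F_M`. -/
def SameLeaf (FM : TangentSubbundle E M) (x y : M) : Prop :=
  ∃ γ : ℝ → M, ContMDiff 𝓘(ℝ) 𝓘(ℝ, E) ∞ γ ∧ γ 0 = x ∧ γ 1 = y ∧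
    ∀ t : ℝ, mfderiv 𝓘(ℝ) 𝓘(ℝ, E) γ t (1 : ℝ) ∈ FM.fiber (γ t)

end SmoothSubbundle

end Tangent

section Ideals

variable {E M F : Type*} [NormedAddCommGroup E] [NormedSpace ℝ E] [FiniteDimensional ℝ E]
  [TopologicalSpace M] [ChartedSpace E M] [IsManifold 𝓘(ℝ, E) ∞ M]
  [NormedAddCommGroup F] [NormedSpace ℝ F]
  {A : M → Type*} [TopologicalSpace (TotalSpace F A)] [∀ x, AddCommGroup (A x)]
  [∀ x, Module ℝ (A x)] [∀ x, TopologicalSpace (A x)] [FiberBundle F A] [VectorBundle ℝ F A]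

variable (E F A) in
/-- A vector bundle with an anchor: a smooth vector bundle map `ρ : A → TM` over the identity. -/
structure AnchoredBundle where
  anchor : ∀ x, A x →ₗ[ℝ] TangentSpace 𝓘(ℝ, E) x
  contMDiff_anchor : ContMDiff (𝓘(ℝ, E).prod 𝓘(ℝ, F)) 𝓘(ℝ, E).tangent ∞
    (fun p : TotalSpace F A => (⟨p.proj, anchor p.proj p.snd⟩ : TangentBundle 𝓘(ℝ, E) M))

/-- The vector field `ρ(a)`. -/
def AnchoredBundle.onSections (𝒜 : AnchoredBundle E F A) (a : SmoothSec E F A) : SmoothVF E M :=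
  ⟨fun x => 𝒜.anchor x (a x), 𝒜.contMDiff_anchor.comp a.contMDiff⟩

variable (E F A) in
/-- A Lie algebroid structure on the vector bundle `A → M`. -/
structure LieAlgebroid extends AnchoredBundle E F A where
  /-- the Lie bracket on `Γ(A)` -/
  bracket : SmoothSec E F A →ₗ[ℝ] SmoothSec E F A →ₗ[ℝ] SmoothSec E F A
  bracket_self : ∀ a, bracket a a = 0
  jacobi : ∀ a b c, bracket a (bracket b c) = bracket (bracket a b) c + bracket b (bracket a c)
  leibniz : ∀ a (f : SmoothFn E M) b,
    bracket a (f • b) = f • bracket a b + ⁅toAnchoredBundle.onSections a, f⁆ • b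
  anchor_bracket : ∀ a b, toAnchoredBundle.onSections (bracket a b) =
    ⁅toAnchoredBundle.onSections a, toAnchoredBundle.onSections b⁆

variable (E F A) in
/-- An involutive subbundle `F_M ⊆ TM`, a subbundle `J ⊆ A` and a flat `F_M`-connection
`∇ : Γ(F_M) × Γ(A/J) → Γ(A/J)`, that is, an infinitesimal ideal system in the vector bundle `A`. -/
structure FlatPartialConnection where
  FM : TangentSubbundle E M
  involutive : FM.IsInvolutive
  J : SmoothSubbundle E F A
  conn : LinearConnection (SmoothFn E M) (FM.lieSections involutive) J.QuotSec
  flat : conn.IsFlat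

namespace FlatPartialConnection

variable (P : FlatPartialConnection E F A)

/-- `Γ(F_M)`, with its module and Lie algebra structures. -/
abbrev leafFields : LieRinehartSubalgebra (SmoothFn E M) (SmoothVF E M) :=
  P.FM.lieSections P.involutive

/-- The section `q` of `A/J` is `∇`-parallel on the set `U`. -/
def IsParallelOn (U : Set M) (q : P.J.QuotSec) : Prop :=
  ∀ X : P.leafFields, ∀ x ∈ U, P.J.evalQuot x (P.conn X q) = 0

/-- The class of the vector field `X` in `TM/F_M` is parallel on `U` for the Bott connection of
`F_M`. -/
def IsBottParallelOn (U : Set M) (X : SmoothVF E M) : Prop :=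
  ∀ Y : P.leafFields, ∀ x ∈ U,
    P.FM.evalQuot x (LinearConnection.bott P.leafFields Y (Submodule.Quotient.mk X)) = 0

/-- Two points of the bundle `A/J` are related by the parallel transport of `∇` along the leaves of
`F_M`: their base points lie in the same leaf and some `∇`-parallel section passes through
both. -/
def ParallelRel (x y : M) (u : A x ⧸ P.J.fiber x) (v : A y ⧸ P.J.fiber y) : Prop :=
  P.FM.SameLeaf x y ∧
    ∃ q : P.J.QuotSec, (∀ X, P.conn X q = 0) ∧ P.J.evalQuot x q = u ∧ P.J.evalQuot y q = v

/-- A linear connection `D : 𝔛(M) × Γ(A) → Γ(A)` is an extension of `∇` if it preserves `Γ(J)` and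
the connection it induces on `A/J` restricts to `∇` on `Γ(F_M)`. -/
structure IsExtension (D : LinearConnection (SmoothFn E M) (SmoothVF E M) (SmoothSec E F A)) :
    Prop where
  preserves : ∀ X, ∀ k ∈ P.J.sections, D X k ∈ P.J.sections
  restricts : ∀ Y : P.leafFields, ∀ q,
    D.quotient P.J.sections preserves (Y : SmoothVF E M) q = P.conn Y q

variable {P} {D : LinearConnection (SmoothFn E M) (SmoothVF E M) (SmoothSec E F A)}

theorem IsExtension.restrict_eq (hD : P.IsExtension D) :
    (D.quotient P.J.sections hD.preserves).restrict P.leafFields = P.conn := by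
  have : ∀ C C' : LinearConnection (SmoothFn E M) P.leafFields P.J.QuotSec,
      C.toFun = C'.toFun → C = C' := by
    rintro ⟨⟩ ⟨⟩ h
    cases h
    rfl
  exact this _ _ (funext fun Y => funext fun q => hD.restricts Y q)

theorem IsExtension.isFlat (hD : P.IsExtension D) :
    ((D.quotient P.J.sections hD.preserves).restrict P.leafFields).IsFlat :=
  hD.restrict_eq.symm ▸ P.flat

/-- The form `ω_D ∈ Ω¹(F_M, Hom(TM/F_M, End(A/J)))`, `ω_D(Y)(X̄)(ā) = class of R_D(Y, X)a`. -/
def atiyahForm (hD : P.IsExtension D) :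
    P.leafFields →ₗ[SmoothFn E M] (SmoothVF E M ⧸ P.leafFields.toSubmodule) →ₗ[SmoothFn E M]
      P.J.QuotSec →ₗ[SmoothFn E M] P.J.QuotSec :=
  (D.quotient P.J.sections hD.preserves).curvatureForm P.leafFields hD.isFlat

theorem atiyahForm_mk (hD : P.IsExtension D) (Y : P.leafFields) (X : SmoothVF E M)
    (a : SmoothSec E F A) :
    atiyahForm hD Y (Submodule.Quotient.mk X) (Submodule.Quotient.mk a) =
      Submodule.Quotient.mk (D.curvature (Y : SmoothVF E M) X a) := rfl

theorem d₁_atiyahForm (hD : P.IsExtension D) :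
    (LinearConnection.bottHom P.conn).d₁ (atiyahForm hD) = 0 := by
  have h : (LinearConnection.bottHom ((D.quotient P.J.sections hD.preserves).restrict
      P.leafFields)).d₁ (atiyahForm hD) = 0 :=
    (D.quotient P.J.sections hD.preserves).d₁_curvatureForm P.leafFields hD.isFlat
  rw [hD.restrict_eq] at h
  exact h

variable (P) in
/-- The cohomology group `H¹(F_M, Hom(TM/F_M, End(A/J)))`. -/
abbrev H1 : Type _ := (LinearConnection.bottHom P.conn).H1

/-- The class `[ω_D]` of an extension `D` of `∇`. -/
def atiyahClass (hD : P.IsExtension D) : P.H1 :=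
  QuotientAddGroup.mk ⟨atiyahForm hD, d₁_atiyahForm hD⟩

end FlatPartialConnection

/-- An infinitesimal ideal system `(F_M, J, ∇)` in the Lie algebroid `A`. Conditions on sections are
conditions on local sections; since local sections extend globally after shrinking their domain,
they are expressed by global sections that satisfy the hypothesis on an open set `U`. -/
structure InfinitesimalIdealSystem (𝒜 : LieAlgebroid E F A) extends
    FlatPartialConnection E F A where
  anchor_mem : ∀ x, ∀ a ∈ J.fiber x, 𝒜.anchor x a ∈ FM.fiber x
  iis1 : ∀ U : Set M, IsOpen U → ∀ a : SmoothSec E F A,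
    toFlatPartialConnection.IsParallelOn U (Submodule.Quotient.mk a) →
    ∀ j : SmoothSec E F A, (∀ x ∈ U, j x ∈ J.fiber x) → ∀ x ∈ U, 𝒜.bracket a j x ∈ J.fiber x
  iis2 : ∀ U : Set M, IsOpen U → ∀ a b : SmoothSec E F A,
    toFlatPartialConnection.IsParallelOn U (Submodule.Quotient.mk a) →
    toFlatPartialConnection.IsParallelOn U (Submodule.Quotient.mk b) →
    toFlatPartialConnection.IsParallelOn U (Submodule.Quotient.mk (𝒜.bracket a b))
  iis3 : ∀ U : Set M, IsOpen U → ∀ a : SmoothSec E F A,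
    toFlatPartialConnection.IsParallelOn U (Submodule.Quotient.mk a) →
    toFlatPartialConnection.IsBottParallelOn U (𝒜.onSections a)

section Morphisms

variable {E' M' F' : Type*} [NormedAddCommGroup E'] [NormedSpace ℝ E'] [FiniteDimensional ℝ E']
  [TopologicalSpace M'] [ChartedSpace E' M'] [IsManifold 𝓘(ℝ, E') ∞ M']
  [NormedAddCommGroup F'] [NormedSpace ℝ F']
  {A' : M' → Type*} [TopologicalSpace (TotalSpace F' A')] [∀ x, AddCommGroup (A' x)]
  [∀ x, Module ℝ (A' x)] [∀ x, TopologicalSpace (A' x)] [FiberBundle F' A']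
  [VectorBundle ℝ F' A']

/-- A morphism of Lie algebroids `A → A'` over `base : M → M'`: a smooth vector bundle map that is
compatible with the anchors and the brackets. -/
structure LieAlgebroidHom (𝒜 : LieAlgebroid E F A) (𝒜' : LieAlgebroid E' F' A') where
  base : M → M'
  contMDiff_base : ContMDiff 𝓘(ℝ, E) 𝓘(ℝ, E') ∞ base
  map : ∀ x, A x →ₗ[ℝ] A' (base x)
  contMDiff_map : ContMDiff (𝓘(ℝ, E).prod 𝓘(ℝ, F)) (𝓘(ℝ, E').prod 𝓘(ℝ, F')) ∞
    (fun p : TotalSpace F A => (⟨base p.proj, map p.proj p.snd⟩ : TotalSpace F' A'))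
  map_anchor : ∀ x (a : A x),
    mfderiv 𝓘(ℝ, E) 𝓘(ℝ, E') base x (𝒜.anchor x a) = 𝒜'.anchor (base x) (map x a)
  /-- If `φ ∘ a = ∑ fᵢ (a'ᵢ ∘ base)` and `φ ∘ b = ∑ gⱼ (b'ⱼ ∘ base)`, then `φ ∘ [a, b]` equals
  `∑ fᵢ gⱼ ([a'ᵢ, b'ⱼ] ∘ base) + ∑ ρ(a)(gⱼ) (b'ⱼ ∘ base) - ∑ ρ(b)(fᵢ) (a'ᵢ ∘ base)`. -/
  map_bracket : ∀ (m n : ℕ) (f : Fin m → SmoothFn E M) (g : Fin n → SmoothFn E M)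
    (a' : Fin m → SmoothSec E' F' A') (b' : Fin n → SmoothSec E' F' A') (a b : SmoothSec E F A),
    (∀ x, map x (a x) = ∑ i, f i x • a' i (base x)) →
    (∀ x, map x (b x) = ∑ j, g j x • b' j (base x)) →
    ∀ x, map x (𝒜.bracket a b x) =
      (∑ i, ∑ j, (f i x * g j x) • 𝒜'.bracket (a' i) (b' j) (base x))
      + (∑ j, ⁅𝒜.onSections a, g j⁆ x • b' j (base x))
      - ∑ i, ⁅𝒜.onSections b, f i⁆ x • a' i (base x)

/-- The Lie algebroid `A' → M'`, with a Lie algebroid morphism `(map, base)` from `A`, is the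
quotient `(A/J)/∇ → M/F_M` of `A` by the infinitesimal ideal system `(F_M, J, ∇)`. -/
structure QuotientLieAlgebroid {𝒜 : LieAlgebroid E F A} (I : InfinitesimalIdealSystem 𝒜)
    (𝒜' : LieAlgebroid E' F' A') extends LieAlgebroidHom 𝒜 𝒜' where
  /-- `M → M'` is a smooth surjective submersion with vertical bundle `F_M` whose fibres are the
  leaves of `F_M`, that is, `M'` is the smooth leaf space `M/F_M`. -/
  base_submersion : Manifold.IsSubmersion 𝓘(ℝ, E) 𝓘(ℝ, E') ∞ base
  base_surjective : Function.Surjective base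
  mem_FM_iff : ∀ x (v : TangentSpace 𝓘(ℝ, E) x),
    v ∈ I.FM.fiber x ↔ mfderiv 𝓘(ℝ, E) 𝓘(ℝ, E') base x v = 0
  base_eq_iff : ∀ x y, base x = base y ↔ I.FM.SameLeaf x y
  /-- `A → A'` is fibrewise surjective and identifies exactly those elements whose classes in
  `A/J` are related by parallel transport, that is, `A'` is `(A/J)/∇`. -/
  map_surjective : ∀ x, Function.Surjective (map x)
  map_eq_iff : ∀ x y (a : A x) (b : A y),
    (⟨base x, map x a⟩ : TotalSpace F' A') = ⟨base y, map y b⟩ ↔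
      I.ParallelRel x y (Submodule.Quotient.mk a) (Submodule.Quotient.mk b)

end Morphisms

end Ideals

end Geometry

/-! If the quotient exists, `π` identifies `A/J` with the pullback of `A'` along the submersion `p :
M → M'`, and the parallel sections of `A/J` descend to `A'`. The pullback of a connection on `A'`
restricts to `∇` along the fibres, and its curvature vanishes as soon as one argument is vertical.
Hence some extension of `∇` has Atiyah form zero. Two extensions agree on `F_M` modulo `J`, so their
difference descends to a 0-cochain with values in `Hom(TM/F_M, End(A/J))`, and its differential is
the difference of the two Atiyah forms. Thus every extension has an exact Atiyah form.

The pullback connection is built directly on `M`, in Grassmann form `D_X a = ∑ X(λᵢ(a)) sᵢ`. The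
`sᵢ` are parallel sections and the `λᵢ` dual functionals vanishing on `J`, with `a = ∑ λᵢ(a) sᵢ`
modulo `J` and with `λᵢ(sⱼ)` constant on the fibres of `p`. Such a frame comes from trivializations
of `A'` and a partition of unity on `M'` (`exists_locallyFiniteFrame`). Because the `sᵢ` are
parallel, `D` restricts to `∇` (`conn_mk_sum`). Because `Y(λᵢ(sⱼ)) = 0` for `Y` in `F_M`, one has
`λᵢ(D_Y a) = Y(λᵢ(a))` (`coeff_deriv`). Together these give `R_D(Y, X) = 0`
(`curvature_connection_eq_zero`). The comparison of two extensions is `exists_d₀_eq_curvatureForm`.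
-/

/-! ## Submersions -/

section Submersions

variable {E M E' M' : Type*} [NormedAddCommGroup E] [NormedSpace ℝ E]
  [TopologicalSpace M] [ChartedSpace E M]
  [NormedAddCommGroup E'] [NormedSpace ℝ E'] [TopologicalSpace M'] [ChartedSpace E' M']

/-- A submersion admits a local section through every point of its domain. -/
theorem Manifold.IsSubmersion.exists_localSection {p : M → M'}
    (hp : IsSubmersion 𝓘(ℝ, E) 𝓘(ℝ, E') ∞ p) (x : M) :
    ∃ σ : M' → M, ContMDiffAt 𝓘(ℝ, E') 𝓘(ℝ, E) ∞ σ (p x) ∧ σ (p x) = x ∧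
      ∀ᶠ y in 𝓝 (p x), p (σ y) = y := by
  obtain ⟨C, _, _, hC⟩ := hp.isSubmersionAt x
  set φ := hC.domChart
  set ψ := hC.codChart
  have hx : x ∈ φ.source := hC.mem_domChart_source
  have hpx : p x ∈ ψ.source := hC.mem_codChart_source
  have hφ : φ ∈ IsManifold.maximalAtlas 𝓘(ℝ, E) ∞ M := hC.domChart_mem_maximalAtlas
  have hψ : ψ ∈ IsManifold.maximalAtlas 𝓘(ℝ, E') ∞ M' := hC.codChart_mem_maximalAtlas
  have hw : ∀ u ∈ φ.target, ψ (p (φ.symm u)) = (hC.equiv u).1 := fun u hu =>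
    hC.writtenInCharts (by simpa using hu)
  -- In the charts `p` is the first projection of a product; the section moves the first coordinate
  -- and keeps the second one equal to that of `x`.
  let τ : M' → E := fun y => hC.equiv.symm (ψ y, (hC.equiv (φ x)).2)
  have hτx : τ (p x) = φ x := by
    have h := hw (φ x) (φ.map_source hx)
    rw [φ.left_inv hx] at h
    simp only [τ, h, Prod.mk.eta, ContinuousLinearEquiv.symm_apply_apply]
  have hτ : ContMDiffAt 𝓘(ℝ, E') 𝓘(ℝ, E) ∞ τ (p x) := by
    have h1 : ContMDiffAt 𝓘(ℝ, E') 𝓘(ℝ, E') ∞ ψ (p x) := contMDiffAt_of_mem_maximalAtlas hψ hpx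
    have h2 : ContDiff ℝ ∞ (fun z : E' => hC.equiv.symm (z, (hC.equiv (φ x)).2)) := by fun_prop
    exact h2.contMDiff.contMDiffAt.comp (p x) h1
  have hs : ContMDiffAt 𝓘(ℝ, E) 𝓘(ℝ, E) ∞ φ.symm (τ (p x)) := by
    rw [hτx]
    exact contMDiffAt_symm_of_mem_maximalAtlas hφ (φ.map_source hx)
  refine ⟨fun y => φ.symm (τ y), hs.comp (p x) hτ, by simp only [hτx, φ.left_inv hx], ?_⟩
  have ht : ∀ᶠ y in 𝓝 (p x), τ y ∈ φ.target := hτ.continuousAt.eventually_mem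
    (φ.open_target.mem_nhds (by rw [hτx]; exact φ.map_source hx))
  filter_upwards [ht, ψ.open_source.mem_nhds hpx] with y hy hy'
  refine ψ.injOn (hC.source_subset_preimage_source (φ.map_target hy)) hy' ?_
  rw [hw _ hy, ContinuousLinearEquiv.apply_symm_apply]

/-- A local section `σ` through `x` is continuous, so it pushes neighbourhoods of `p x` into the
neighbourhood filter of `x`, and `p ∘ σ` is the identity near `p x`. -/
theorem Manifold.IsSubmersion.isOpenMap {p : M → M'}
    (hp : IsSubmersion 𝓘(ℝ, E) 𝓘(ℝ, E') ∞ p) : IsOpenMap p := by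
  refine isOpenMap_iff_nhds_le.2 fun x => ?_
  obtain ⟨σ, hσ, hσx, hpσ⟩ := hp.exists_localSection x
  have h1 : Filter.Tendsto σ (𝓝 (p x)) (𝓝 x) := by
    simpa only [ContinuousAt, hσx] using hσ.continuousAt
  calc 𝓝 (p x) = Filter.map (p ∘ σ) (𝓝 (p x)) := by
        rw [Filter.map_congr (m₁ := p ∘ σ) (m₂ := fun y => y) hpσ, Filter.map_id']
    _ = Filter.map p (Filter.map σ (𝓝 (p x))) := Filter.map_map.symm
    _ ≤ Filter.map p (𝓝 x) := Filter.map_mono h1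

/-- A smooth function that is constant on the fibres of a submersion is annihilated by vertical
vectors. -/
theorem Manifold.IsSubmersion.mvfderiv_eq_zero {p : M → M'}
    (hp : IsSubmersion 𝓘(ℝ, E) 𝓘(ℝ, E') ∞ p) {f : M → ℝ}
    (hf : ContMDiff 𝓘(ℝ, E) 𝓘(ℝ) ∞ f) (hpf : ∀ x y, p x = p y → f x = f y) {x : M}
    {v : TangentSpace 𝓘(ℝ, E) x} (hv : mfderiv 𝓘(ℝ, E) 𝓘(ℝ, E') p x v = 0) :
    mvfderiv 𝓘(ℝ, E) f x v = 0 := by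
  obtain ⟨σ, hσ, hσx, hpσ⟩ := hp.exists_localSection x
  have hpx : MDifferentiableAt 𝓘(ℝ, E) 𝓘(ℝ, E') p x := hp.contMDiff.mdifferentiable (by simp) x
  -- Points `y` and `σ (p y)` lie in the same fibre, so `f` factors smoothly through `p` near `x`,
  -- and the chain rule makes `df` factor through `dp`.
  have heq : f =ᶠ[𝓝 x] (f ∘ σ) ∘ p := by
    filter_upwards [hpx.continuousAt.eventually hpσ] with y hy
    exact hpf _ _ hy.symm
  have hfσ : MDifferentiableAt 𝓘(ℝ, E') 𝓘(ℝ) (f ∘ σ) (p x) :=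
    ((hf.contMDiffAt (x := σ (p x))).comp (p x) hσ).mdifferentiableAt (by simp)
  have h : mfderiv 𝓘(ℝ, E) 𝓘(ℝ) f x v = 0 := by
    rw [heq.mfderiv_eq, mfderiv_comp x hfσ hpx]
    change (mfderiv 𝓘(ℝ, E') 𝓘(ℝ) (f ∘ σ) (p x)) (mfderiv 𝓘(ℝ, E) 𝓘(ℝ, E') p x v) = 0
    rw [hv, map_zero]
  exact h

end Submersions

/-! ## Locally finite dual bases and their Grassmann connections -/

noncomputable section Frames

section Basic

variable {E M F : Type*} [NormedAddCommGroup E] [NormedSpace ℝ E]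
  [TopologicalSpace M] [ChartedSpace E M] [NormedAddCommGroup F] [NormedSpace ℝ F]
  {A : M → Type*} [TopologicalSpace (TotalSpace F A)] [∀ x, AddCommGroup (A x)]
  [∀ x, Module ℝ (A x)] [∀ x, TopologicalSpace (A x)] [FiberBundle F A] [VectorBundle ℝ F A]

theorem SmoothSec.sum_apply {ι : Type*} (t : Finset ι) (s : ι → SmoothSec E F A) (x : M) :
    (∑ i ∈ t, s i) x = ∑ i ∈ t, s i x :=
  map_sum (SmoothSec.evalAt x) s t

theorem SmoothVF.lie_fn_congr [IsManifold 𝓘(ℝ, E) ∞ M] (X : SmoothVF E M) {f g : SmoothFn E M}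
    {x : M} (h : ∀ᶠ y in 𝓝 x, f y = g y) : ⁅X, f⁆ x = ⁅X, g⁆ x := by
  have h1 : mfderiv 𝓘(ℝ, E) 𝓘(ℝ) f x = mfderiv 𝓘(ℝ, E) 𝓘(ℝ) g x := by
    have h2 : (f : M → ℝ) =ᶠ[𝓝 x] g := h
    rw [h2.mfderiv_eq]
  exact DFunLike.congr_fun h1 (X x)

/-- A locally finite family of smooth sections of `A` with dual functionals, which represents every
section of `A` modulo the family of subspaces `N`. -/
structure LocallyFiniteFrame (ι : Type*) (E F : Type*) {M : Type*} [NormedAddCommGroup E]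
    [NormedSpace ℝ E] [TopologicalSpace M] [ChartedSpace E M] [NormedAddCommGroup F]
    [NormedSpace ℝ F] {A : M → Type*} [TopologicalSpace (TotalSpace F A)]
    [∀ x, AddCommGroup (A x)] [∀ x, Module ℝ (A x)] [∀ x, TopologicalSpace (A x)]
    [FiberBundle F A] [VectorBundle ℝ F A] (N : ∀ x, Submodule ℝ (A x)) where
  sec : ι → SmoothSec E F A
  coeff : ι → SmoothSec E F A →ₗ[SmoothFn E M] SmoothFn E M
  supp : ι → Set M
  isClosed_supp : ∀ i, IsClosed (supp i)
  locallyFinite_supp : LocallyFinite supp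
  coeff_eq_zero_of_notMem : ∀ i a, ∀ x ∉ supp i, coeff i a x = 0
  coeff_eq_zero_of_mem : ∀ i a x, a x ∈ N x → coeff i a x = 0
  sub_sum_mem : ∀ (t : Finset ι) a x, (∀ i, x ∈ supp i → i ∈ t) →
    a x - ∑ i ∈ t, coeff i a x • sec i x ∈ N x

namespace LocallyFiniteFrame

variable {ι : Type*} {N : ∀ x, Submodule ℝ (A x)} (e : LocallyFiniteFrame ι E F N)

/-- Families of functions that are supported in the supports of the frame. -/
def coeffModule : Submodule (SmoothFn E M) (ι → SmoothFn E M) where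
  carrier := {c | ∀ i, ∀ x ∉ e.supp i, c i x = 0}
  add_mem' := fun {c d} hc hd i x hx => by
    change c i x + d i x = 0
    rw [hc i x hx, hd i x hx, add_zero]
  zero_mem' _ _ _ := rfl
  smul_mem' f c hc i x hx := by
    change f x * c i x = 0
    rw [hc i x hx, mul_zero]

/-- One finite index set serves a whole neighbourhood of `x`, so locally finite sums may be treated
as finite ones even under differentiation. -/
theorem exists_finset (x : M) :
    ∃ t : Finset ι, ∀ᶠ y in 𝓝 x, ∀ i, y ∈ e.supp i → i ∈ t := by
  obtain ⟨U, hU, hfin⟩ := e.locallyFinite_supp x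
  refine ⟨hfin.toFinset, ?_⟩
  filter_upwards [hU] with y hy i hi
  exact hfin.mem_toFinset.2 ⟨y, hi, hy⟩

theorem finsum_eq (c : e.coeffModule) {x : M} {t : Finset ι}
    (ht : ∀ i, x ∈ e.supp i → i ∈ t) :
    ∑ᶠ i, c.1 i x • e.sec i x = ∑ i ∈ t, c.1 i x • e.sec i x := by
  refine finsum_eq_sum_of_support_subset _ fun i hi => ?_
  refine ht i (by_contra fun h => hi ?_)
  simp only [c.2 i x h, zero_smul]

/-- The locally finite sum `∑ᵢ cᵢ sᵢ` over the frame. -/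
def sum : e.coeffModule →ₗ[SmoothFn E M] SmoothSec E F A where
  toFun c := ⟨fun x => ∑ᶠ i, c.1 i x • e.sec i x, by
    refine ContMDiff.finsum_section_of_locallyFinite ?_
      fun i => (c.1 i).contMDiff.smul_section (e.sec i).contMDiff
    refine e.locallyFinite_supp.subset fun i x hx => by_contra fun h => hx ?_
    simp only [c.2 i x h, zero_smul]⟩
  map_add' c d := by
    ext x
    obtain ⟨t, ht⟩ := e.exists_finset x
    change ∑ᶠ i, (c + d).1 i x • e.sec i x =
      ∑ᶠ i, c.1 i x • e.sec i x + ∑ᶠ i, d.1 i x • e.sec i x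
    rw [e.finsum_eq _ ht.self_of_nhds, e.finsum_eq _ ht.self_of_nhds,
      e.finsum_eq _ ht.self_of_nhds, ← Finset.sum_add_distrib]
    exact Finset.sum_congr rfl fun i _ => add_smul (c.1 i x) (d.1 i x) _
  map_smul' f c := by
    ext x
    obtain ⟨t, ht⟩ := e.exists_finset x
    change ∑ᶠ i, (f • c).1 i x • e.sec i x = f x • ∑ᶠ i, c.1 i x • e.sec i x
    rw [e.finsum_eq _ ht.self_of_nhds, e.finsum_eq _ ht.self_of_nhds, Finset.smul_sum]
    exact Finset.sum_congr rfl fun i _ => mul_smul (f x) (c.1 i x) _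

theorem sum_apply (c : e.coeffModule) {x : M} {t : Finset ι} (ht : ∀ i, x ∈ e.supp i → i ∈ t) :
    e.sum c x = (∑ i ∈ t, c.1 i • e.sec i) x :=
  (e.finsum_eq c ht).trans (SmoothSec.sum_apply t (fun i => c.1 i • e.sec i) x).symm

/-- The coefficients of a section. -/
def coeffs : SmoothSec E F A →ₗ[SmoothFn E M] e.coeffModule :=
  (LinearMap.pi e.coeff).codRestrict e.coeffModule fun a i => e.coeff_eq_zero_of_notMem i a

/-- The endomorphism `a ↦ ∑ᵢ λᵢ(a) sᵢ` of `Γ(A)`. -/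
def proj : SmoothSec E F A →ₗ[SmoothFn E M] SmoothSec E F A := e.sum ∘ₗ e.coeffs

theorem proj_apply (a : SmoothSec E F A) {x : M} {t : Finset ι}
    (ht : ∀ i, x ∈ e.supp i → i ∈ t) : e.proj a x = (∑ i ∈ t, e.coeff i a • e.sec i) x :=
  e.sum_apply (e.coeffs a) ht

theorem sub_proj_mem (a : SmoothSec E F A) (x : M) : (a - e.proj a) x ∈ N x := by
  obtain ⟨t, ht⟩ := e.exists_finset x
  change a x - e.proj a x ∈ N x
  rw [e.proj_apply a ht.self_of_nhds, SmoothSec.sum_apply]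
  exact e.sub_sum_mem t a x ht.self_of_nhds

/-- The functionals see only the value at `x` modulo `N x`; this allows a section to be replaced by
its finite expansion in the frame. -/
theorem coeff_congr (i : ι) {a b : SmoothSec E F A} {x : M} (h : a x - b x ∈ N x) :
    e.coeff i a x = e.coeff i b x := by
  have h1 : e.coeff i (a - b) x = 0 := e.coeff_eq_zero_of_mem i (a - b) x h
  rw [map_sub] at h1
  exact sub_eq_zero.1 h1

theorem proj_eq_zero {a : SmoothSec E F A} (ha : ∀ x, a x ∈ N x) : e.proj a = 0 := by
  have : e.coeffs a = 0 := by
    ext i x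
    exact e.coeff_eq_zero_of_mem i a x (ha x)
  rw [proj, LinearMap.comp_apply, this, map_zero]

/-- `a - e.proj a` takes values in `N`, and `e.proj` kills such sections. Thus `e.proj` is a
projector whose kernel is the sections of `N`, which splits `Γ(A)`. -/
theorem proj_proj (a : SmoothSec E F A) : e.proj (e.proj a) = e.proj a := by
  have h := e.proj_eq_zero (e.sub_proj_mem a)
  rw [map_sub] at h
  exact (sub_eq_zero.1 h).symm

theorem proj_eq_self {ι₀ : Type*}
    (e₀ : LocallyFiniteFrame ι₀ E F (fun x => (⊥ : Submodule ℝ (A x))))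
    (a : SmoothSec E F A) : e₀.proj a = a := by
  ext x
  exact (sub_eq_zero.1 ((Submodule.mem_bot ℝ).1 (e₀.sub_proj_mem a x))).symm

section Derivative

variable [IsManifold 𝓘(ℝ, E) ∞ M]

/-- The complement of a closed support is open, so a coefficient vanishing there has zero derivative
there. -/
theorem lie_coeffs_mem (X : SmoothVF E M) (c : e.coeffModule) :
    (fun i => ⁅X, c.1 i⁆) ∈ e.coeffModule := fun i x hx => by
  have h : ∀ᶠ y in 𝓝 x, c.1 i y = (0 : SmoothFn E M) y := by
    filter_upwards [(e.isClosed_supp i).isOpen_compl.mem_nhds hx] with y hy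
    exact c.2 i y hy
  have h0 : mfderiv 𝓘(ℝ, E) 𝓘(ℝ) (fun _ : M => (0 : ℝ)) x = 0 := mfderiv_const
  exact (X.lie_fn_congr h).trans (DFunLike.congr_fun h0 (X x))

/-- The Grassmann operator `a ↦ ∑ᵢ X(λᵢ(a)) sᵢ`. -/
def deriv (X : SmoothVF E M) (a : SmoothSec E F A) : SmoothSec E F A :=
  e.sum ⟨fun i => ⁅X, e.coeff i a⁆, e.lie_coeffs_mem X (e.coeffs a)⟩

theorem deriv_apply (X : SmoothVF E M) (a : SmoothSec E F A) {x : M} {t : Finset ι}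
    (ht : ∀ i, x ∈ e.supp i → i ∈ t) :
    e.deriv X a x = (∑ i ∈ t, ⁅X, e.coeff i a⁆ • e.sec i) x :=
  e.sum_apply _ ht

variable [FiniteDimensional ℝ E]

theorem deriv_eq_zero (X : SmoothVF E M) {a : SmoothSec E F A} (ha : ∀ x, a x ∈ N x) :
    e.deriv X a = 0 := by
  have h : ∀ i, e.coeff i a = 0 := fun i => by
    ext x
    exact e.coeff_eq_zero_of_mem i a x (ha x)
  have : (⟨fun i => ⁅X, e.coeff i a⁆, e.lie_coeffs_mem X (e.coeffs a)⟩ : e.coeffModule) = 0 := by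
    ext1
    funext i
    change ⁅X, e.coeff i a⁆ = 0
    rw [h, lie_zero]
  rw [deriv, this, map_zero]

theorem deriv_add_left (X Y : SmoothVF E M) (a : SmoothSec E F A) :
    e.deriv (X + Y) a = e.deriv X a + e.deriv Y a := by
  rw [deriv, deriv, deriv, ← map_add]
  congr 1
  ext1
  funext i
  exact add_lie X Y _

theorem deriv_smul_left (f : SmoothFn E M) (X : SmoothVF E M) (a : SmoothSec E F A) :
    e.deriv (f • X) a = f • e.deriv X a := by
  rw [deriv, deriv, ← map_smul]
  congr 1
  ext1
  funext i
  exact LieRinehartRing.lie_smul_eq_mul f _ X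

theorem deriv_add_right (X : SmoothVF E M) (a b : SmoothSec E F A) :
    e.deriv X (a + b) = e.deriv X a + e.deriv X b := by
  rw [deriv, deriv, deriv, ← map_add]
  congr 1
  ext1
  funext i
  change ⁅X, e.coeff i (a + b)⁆ = ⁅X, e.coeff i a⁆ + ⁅X, e.coeff i b⁆
  rw [map_add, lie_add]

/-- The Leibniz term carries `e.proj a` in place of `a`, so the Grassmann operator is a connection
only modulo `N`. -/
theorem deriv_smul_right (X : SmoothVF E M) (f : SmoothFn E M) (a : SmoothSec E F A) :
    e.deriv X (f • a) = f • e.deriv X a + ⁅X, f⁆ • e.proj a := by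
  rw [deriv, deriv, proj, LinearMap.comp_apply, ← map_smul, ← map_smul, ← map_add]
  congr 1
  ext1
  funext i
  change ⁅X, e.coeff i (f • a)⁆ = f • ⁅X, e.coeff i a⁆ + ⁅X, f⁆ • e.coeff i a
  rw [map_smul, smul_eq_mul, LieRinehartRing.leibniz_mul_right, smul_eq_mul ⁅X, f⁆]

end Derivative

end LocallyFiniteFrame

end Basic

end Frames

/-! ### Existence of frames of descending sections -/

noncomputable section FrameExistence

variable {E M F : Type*} [NormedAddCommGroup E] [NormedSpace ℝ E]
  [TopologicalSpace M] [ChartedSpace E M] [NormedAddCommGroup F] [NormedSpace ℝ F]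
  {A : M → Type*} [TopologicalSpace (TotalSpace F A)] [∀ x, AddCommGroup (A x)]
  [∀ x, Module ℝ (A x)] [∀ x, TopologicalSpace (A x)] [FiberBundle F A] [VectorBundle ℝ F A]
  {E' M' F' : Type*} [NormedAddCommGroup E'] [NormedSpace ℝ E'] [FiniteDimensional ℝ E']
  [TopologicalSpace M'] [T2Space M'] [SigmaCompactSpace M'] [ChartedSpace E' M']
  [IsManifold 𝓘(ℝ, E') ∞ M']
  [NormedAddCommGroup F'] [NormedSpace ℝ F'] [FiniteDimensional ℝ F']
  {A' : M' → Type*} [TopologicalSpace (TotalSpace F' A')] [∀ x, AddCommGroup (A' x)]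
  [∀ x, Module ℝ (A' x)] [∀ x, TopologicalSpace (A' x)] [FiberBundle F' A']
  [VectorBundle ℝ F' A'] [ContMDiffVectorBundle ∞ F' A' 𝓘(ℝ, E')]

/-- The endomorphism of `V` that maps the basis `b` to the vectors `v`. -/
def Module.Basis.endOf {V : Type*} [NormedAddCommGroup V] [NormedSpace ℝ V]
    [FiniteDimensional ℝ V] {κ : Type*} [Fintype κ] (b : Module.Basis κ ℝ V) (v : κ → V) :
    V →L[ℝ] V :=
  ∑ j, (b.coord j).toContinuousLinearMap.smulRight (v j)

theorem Module.Basis.endOf_apply {V : Type*} [NormedAddCommGroup V] [NormedSpace ℝ V]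
    [FiniteDimensional ℝ V] {κ : Type*} [Fintype κ] (b : Module.Basis κ ℝ V) (v : κ → V) (w : V) :
    b.endOf v w = ∑ j, b.coord j w • v j := by
  simp [Module.Basis.endOf]

theorem Module.Basis.endOf_self {V : Type*} [NormedAddCommGroup V] [NormedSpace ℝ V]
    [FiniteDimensional ℝ V] {κ : Type*} [Fintype κ] (b : Module.Basis κ ℝ V) :
    b.endOf b = 1 := by
  ext w
  rw [b.endOf_apply]
  exact b.sum_repr w

/-- For a fibrewise surjective vector bundle map `φ : A → A'` over an open surjection `p`, and a
set `S` of sections of `A` that pass through every point of `A` modulo `ker φ` and that descend to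
`A'`, there is a locally finite frame modulo `ker φ` consisting of elements of `S`, whose
functionals take values in functions on `M'` on `S`. -/
theorem exists_locallyFiniteFrame {p : M → M'} (hp : ContMDiff 𝓘(ℝ, E) 𝓘(ℝ, E') ∞ p)
    (hpo : IsOpenMap p) (hps : Function.Surjective p) (φ : ∀ x, A x →ₗ[ℝ] A' (p x))
    (hφ : ContMDiff (𝓘(ℝ, E).prod 𝓘(ℝ, F)) (𝓘(ℝ, E').prod 𝓘(ℝ, F')) ∞
      (fun z : TotalSpace F A => (⟨p z.proj, φ z.proj z.snd⟩ : TotalSpace F' A')))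
    (hφs : ∀ x, Function.Surjective (φ x)) (S : Set (SmoothSec E F A))
    (hS : ∀ x (a : A x), ∃ s ∈ S, φ x (s x) = φ x a)
    (hS' : ∀ s ∈ S, ∀ x y, p x = p y →
      (⟨p x, φ x (s x)⟩ : TotalSpace F' A') = ⟨p y, φ y (s y)⟩) :
    ∃ e : LocallyFiniteFrame (M' × Fin (Module.finrank ℝ F')) E F (fun x => LinearMap.ker (φ x)),
      (∀ i, e.sec i ∈ S) ∧ ∀ i, ∀ s ∈ S, ∀ x y, p x = p y → e.coeff i s x = e.coeff i s y := by
  have := FiniteDimensional.complete ℝ F'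
  let κ := Fin (Module.finrank ℝ F')
  let b : Module.Basis κ ℝ F' := Module.finBasis ℝ F'
  let τ : ∀ y : M', Trivialization F' (π F' A') := fun y => trivializationAt F' A' y
  -- the representation of `φ ∘ a` in the trivialization of `A'` at `y`
  let L : ∀ (y : M') (x : M), A x →ₗ[ℝ] F' := fun y x => (τ y).linearMapAt ℝ (p x) ∘ₗ φ x
  have hL : ∀ y x (a : A x), p x ∈ (τ y).baseSet → L y x a = (τ y ⟨p x, φ x a⟩).2 :=
    fun y x a hx => by
      simp only [L, LinearMap.comp_apply, (τ y).coe_linearMapAt_of_mem hx]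
  have hLsm : ∀ (y : M') (a : SmoothSec E F A) (x : M), p x ∈ (τ y).baseSet →
      ContMDiffAt 𝓘(ℝ, E) 𝓘(ℝ, F') ∞ (fun z => L y z (a z)) x := fun y a x hx => by
    have h1 : ContMDiffAt 𝓘(ℝ, E) (𝓘(ℝ, E').prod 𝓘(ℝ, F')) ∞
        (fun z => (⟨p z, φ z (a z)⟩ : TotalSpace F' A')) x := (hφ.comp a.contMDiff) x
    have h2 := (((τ y).contMDiffAt_iff (f := fun z => (⟨p z, φ z (a z)⟩ : TotalSpace F' A'))
      ((τ y).mem_source.2 hx)).1 h1).2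
    refine h2.congr_of_eventuallyEq ?_
    filter_upwards [hp.continuous.continuousAt.eventually_mem
      ((τ y).open_baseSet.mem_nhds hx)] with z hz
    exact hL y z (a z) hz
  -- It suffices to prescribe `s` at one point over `y`: members of `S` descend, so the image is the
  -- same at all other points of the fibre.
  have hex : ∀ (y : M') (j : κ), ∃ s ∈ S, ∀ x, p x = y → L y x (s x) = b j := fun y j => by
    obtain ⟨x, rfl⟩ := hps y
    have hx : p x ∈ (τ (p x)).baseSet := FiberBundle.mem_baseSet_trivializationAt' (p x)
    obtain ⟨a, ha⟩ := hφs x ((τ (p x)).symm (p x) (b j))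
    obtain ⟨s, hs, hsa⟩ := hS x a
    refine ⟨s, hs, fun z hz => ?_⟩
    rw [hL _ _ _ (hz ▸ hx), hS' s hs z x hz, hsa, ha, (τ (p x)).apply_mk_symm hx]
  choose s hsS hsb using hex
  -- The matrix of the images of `s y j` in the trivialization at `y`. It is the identity over `y`,
  -- hence invertible nearby, and it is constant on the fibres of `p`.
  let T : M' → M → F' →L[ℝ] F' := fun y x => b.endOf fun j => L y x (s y j x)
  have hTsm : ∀ (y : M') (x : M), p x ∈ (τ y).baseSet →
      ContMDiffAt 𝓘(ℝ, E) 𝓘(ℝ, F' →L[ℝ] F') ∞ (T y) x := fun y x hx => by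
    suffices h : ContMDiffAt 𝓘(ℝ, E) 𝓘(ℝ, F' →L[ℝ] F') ∞ (fun z => ∑ j : κ,
        (b.coord j).toContinuousLinearMap.smulRight (L y z (s y j z))) x from h
    refine contMDiffAt_finsetSum fun j _ => ?_
    have h1 : ContDiff ℝ ∞ (fun v : F' => (b.coord j).toContinuousLinearMap.smulRight v) :=
      (ContinuousLinearMap.smulRightL ℝ F' F' (b.coord j).toContinuousLinearMap).contDiff
    exact h1.contMDiff.contMDiffAt.comp x (hLsm y (s y j) x hx)
  have hLp : ∀ (y : M'), ∀ r ∈ S, ∀ x z, p x = p z → L y x (r x) = L y z (r z) :=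
    fun y r hr x z hxz => by
      have h : ∀ u v : TotalSpace F' A', u = v →
          (τ y).linearMapAt ℝ u.proj u.snd = (τ y).linearMapAt ℝ v.proj v.snd := by
        rintro u _ rfl
        rfl
      exact h _ _ (hS' r hr x z hxz)
  have hTp : ∀ y x z, p x = p z → T y x = T y z := fun y x z hxz => by
    simp only [T, fun j => hLp y _ (hsS y j) x z hxz]
  -- the set over which the sections `s y j` form a frame
  let V : M' → Set M := fun y => {x | p x ∈ (τ y).baseSet ∧ IsUnit (T y x)}
  have hVo : ∀ y, IsOpen (V y) := fun y => isOpen_iff_mem_nhds.2 fun x hx => by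
    filter_upwards [hp.continuous.continuousAt.eventually_mem
      ((τ y).open_baseSet.mem_nhds hx.1),
      (hTsm y x hx.1).continuousAt.eventually_mem (Units.isOpen.mem_nhds hx.2)] with z hz hz'
    exact ⟨hz, hz'⟩
  -- `V y` is a union of fibres, so a partition of unity subordinate to the images on `M'` pulls
  -- back to one subordinate to the `V y`.
  have hVp : ∀ y x, p x ∈ p '' V y → x ∈ V y := by
    rintro y x ⟨z, hz, hzx⟩
    exact ⟨hzx ▸ hz.1, hTp y z x hzx ▸ hz.2⟩
  have hVc : (Set.univ : Set M') ⊆ ⋃ y, p '' V y := fun y _ => by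
    refine Set.mem_iUnion.2 ⟨y, ?_⟩
    obtain ⟨x, rfl⟩ := hps y
    refine ⟨x, ⟨FiberBundle.mem_baseSet_trivializationAt' (p x), ?_⟩, rfl⟩
    have : T (p x) x = 1 := by
      simp only [T, fun j => hsb (p x) j x rfl]
      exact b.endOf_self
    rw [this]
    exact isUnit_one
  obtain ⟨ρ, hρ⟩ := SmoothPartitionOfUnity.exists_isSubordinate 𝓘(ℝ, E') isClosed_univ
    (fun y => p '' V y) (fun y => hpo _ (hVo y)) hVc
  -- By Cramer's rule the coordinates of `φ a` in the frame `φ (s y j)` are those of `T⁻¹ (L a)` in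
  -- `b`. The default values of `Ring.inverse` and of the trivialization occur only where `ρ`
  -- vanishes.
  let G : ∀ (i : M' × κ) (x : M), A x → ℝ := fun i x a =>
    ρ i.1 (p x) * b.coord i.2 (Ring.inverse (T i.1 x) (L i.1 x a))
  have hG0 : ∀ i x (a : A x), p x ∉ tsupport (ρ i.1) → G i x a = 0 := fun i x a hx => by
    simp only [G, image_eq_zero_of_notMem_tsupport hx, zero_mul]
  have hGsm : ∀ i (a : SmoothSec E F A),
      ContMDiff 𝓘(ℝ, E) 𝓘(ℝ) ∞ (fun x => G i x (a x)) := fun i a x => by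
    by_cases hx : p x ∈ tsupport (ρ i.1)
    · have hxV := hVp i.1 x (hρ i.1 hx)
      have h1 : ContMDiffAt 𝓘(ℝ, E) 𝓘(ℝ) ∞ (fun x => ρ i.1 (p x)) x :=
        ((ρ i.1).contMDiff.comp hp) x
      obtain ⟨u, hu⟩ := hxV.2
      have h2 : ContMDiffAt 𝓘(ℝ, E) 𝓘(ℝ, F' →L[ℝ] F') ∞ (fun x => Ring.inverse (T i.1 x)) x := by
        have h := contDiffAt_ringInverse ℝ (n := ∞) u
        rw [hu] at h
        exact h.contMDiffAt.comp x (hTsm i.1 x hxV.1)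
      have h3 := h2.clm_apply (hLsm i.1 a x hxV.1)
      have h4 : ContDiff ℝ ∞ (b.coord i.2) :=
        (b.coord i.2).toContinuousLinearMap.contDiff
      exact h1.mul (h4.contMDiff.contMDiffAt.comp x h3)
    · refine (contMDiffAt_const (c := (0 : ℝ))).congr_of_eventuallyEq ?_
      filter_upwards [hp.continuous.continuousAt.eventually_mem
        ((isClosed_tsupport (ρ i.1)).isOpen_compl.mem_nhds hx)] with z hz
      exact hG0 i z _ hz
  have hGadd : ∀ i x (a c : A x), G i x (a + c) = G i x a + G i x c := fun i x a c => by
    simp only [G, map_add, mul_add]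
  have hGsmul : ∀ i x (r : ℝ) (a : A x), G i x (r • a) = r * G i x a := fun i x r a => by
    simp only [G, map_smul, smul_eq_mul]
    ring
  -- The identity is `T (T⁻¹ (L a)) = L a` expanded in the basis, followed by cancelling the
  -- trivialization, which is injective on the fibre.
  have hspan : ∀ (y : M') (x : M) (a : A x), p x ∈ tsupport (ρ y) →
      ∑ j, b.coord j (Ring.inverse (T y x) (L y x a)) • φ x (s y j x) = φ x a :=
    fun y x a hx => by
      have hxV := hVp y x (hρ y hx)
      have hinj : Function.Injective ((τ y).linearMapAt ℝ (p x)) := by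
        rw [(τ y).coe_linearMapAt_of_mem hxV.1]
        exact ((τ y).linearEquivAt ℝ (p x) hxV.1).injective
      apply hinj
      rw [map_sum]
      have h1 := b.endOf_apply (fun j => L y x (s y j x)) (Ring.inverse (T y x) (L y x a))
      have h2 : T y x (Ring.inverse (T y x) (L y x a)) = L y x a := by
        rw [← mul_apply_eq_comp, Ring.mul_inverse_cancel _ hxV.2]
        rfl
      refine Eq.trans ?_ (h1.symm.trans h2)
      exact Finset.sum_congr rfl fun j _ => map_smul _ _ _
  refine ⟨{
    sec := fun i => s i.1 i.2
    coeff := fun i =>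
      { toFun := fun a => ⟨fun x => G i x (a x), hGsm i a⟩
        map_add' := fun a c => by
          ext x
          exact hGadd i x (a x) (c x)
        map_smul' := fun f a => by
          ext x
          exact hGsmul i x (f x) (a x) }
    supp := fun i => p ⁻¹' tsupport (ρ i.1)
    isClosed_supp := fun i => (isClosed_tsupport _).preimage hp.continuous
    locallyFinite_supp := ?_
    coeff_eq_zero_of_notMem := fun i a x hx => hG0 i x (a x) hx
    coeff_eq_zero_of_mem := ?_
    sub_sum_mem := ?_ }, fun i => hsS i.1 i.2, ?_⟩
  · intro x
    obtain ⟨U, hU, hfin⟩ := ρ.locallyFinite.closure (p x)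
    refine ⟨p ⁻¹' U, hp.continuous.continuousAt hU, ?_⟩
    refine (hfin.prod (Set.finite_univ (α := κ))).subset ?_
    rintro i ⟨z, hz, hzU⟩
    exact ⟨⟨p z, hz, hzU⟩, trivial⟩
  · intro i a x ha
    have h : L i.1 x (a x) = 0 := by
      simp only [L, LinearMap.comp_apply, LinearMap.mem_ker.1 ha, map_zero]
    change G i x (a x) = 0
    simp only [G, h, map_zero, mul_zero]
  · intro t a x ht
    change a x - ∑ i ∈ t, G i x (a x) • s i.1 i.2 x ∈ LinearMap.ker (φ x)
    rw [LinearMap.mem_ker, map_sub, map_sum, sub_eq_zero]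
    -- The supports of the frame are preimages of closed supports, so `fintsupport` is contained in
    -- `t`; the remaining indices contribute zero.
    have hsub : ρ.fintsupport (p x) ×ˢ (Finset.univ : Finset κ) ⊆ t := fun i hi =>
      ht i ((ρ.mem_fintsupport_iff (p x) i.1).1 (Finset.mem_product.1 hi).1)
    rw [← Finset.sum_subset hsub fun i _ hi => ?_, Finset.sum_product]
    · have h : ∀ y ∈ ρ.fintsupport (p x), ∑ j, φ x (G (y, j) x (a x) • s y j x)
          = ρ y (p x) • φ x (a x) := fun y hy => by
        rw [← hspan y x (a x) ((ρ.mem_fintsupport_iff (p x) y).1 hy), Finset.smul_sum]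
        refine Finset.sum_congr rfl fun j _ => ?_
        rw [map_smul, smul_smul]
      rw [Finset.sum_congr rfl h, ← Finset.sum_smul,
        ρ.sum_finsupport' _ (Set.mem_univ _) (ρ.finsupport_subset_fintsupport (p x)), one_smul]
    · have hi' : p x ∉ tsupport (ρ i.1) := fun h => hi (Finset.mem_product.2
        ⟨(ρ.mem_fintsupport_iff (p x) i.1).2 h, Finset.mem_univ _⟩)
      rw [hG0 i x _ hi', zero_smul, map_zero]
  · intro i r hr x z hxz
    change G i x (r x) = G i z (r z)
    simp only [G, hxz, hTp i.1 x z hxz, hLp i.1 r hr x z hxz]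

end FrameExistence

/-! ## Exactness of the curvature form -/

namespace LinearConnection

theorem mk_eq_zero_of_d₀_eq {R L V : Type*} [CommRing R] [LieRing L] [Module R L]
    [LieRingModule L R] [LieRinehartRing R L] [AddCommGroup V] [Module R V]
    (D : LinearConnection R L V) (η : D.d₁.ker) {v : V} (h : D.d₀ v = η) :
    (QuotientAddGroup.mk η : D.H1) = 0 :=
  (QuotientAddGroup.eq_zero_iff _).2 (AddSubgroup.mem_addSubgroupOf.2 ⟨v, h⟩)

/-- If two `L`-connections on `Q` restrict to the same `K`-connection and the curvature of the first
one vanishes on `K × L`, then the curvature form of the second one is exact. -/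
theorem exists_d₀_eq_curvatureForm {R L Q : Type*} [CommRing R] [LieRing L] [Module R L]
    [LieRingModule L R] [LieRinehartRing R L] [AddCommGroup Q] [Module R Q]
    (K : LieRinehartSubalgebra R L) (P : LinearConnection R K Q) (C C' : LinearConnection R L Q)
    (hC : ∀ (Y : K) q, C (Y : L) q = P Y q) (hC' : ∀ (Y : K) q, C' (Y : L) q = P Y q)
    (hcurv : ∀ (Y : K) (X : L) q, C.curvature (Y : L) X q = 0)
    (hflat : (C'.restrict K).IsFlat) :
    ∃ ψ, (bottHom P).d₀ ψ = C'.curvatureForm K hflat := by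
  -- The derivation terms cancel in `C' - C`, so it is a tensor; it vanishes on `K` and descends to
  -- `L ⧸ K`.
  let ψ₀ : L →ₗ[R] Q →ₗ[R] Q := LinearMap.mk₂ R (fun X q => C' X q - C X q)
    (fun X Y q => by simp only [add_left]; abel)
    (fun f X q => by simp only [smul_left, smul_sub])
    (fun X p q => by simp only [add_right]; abel)
    (fun f X q => by simp only [leibniz, smul_sub]; abel)
  have hψ₀ : ∀ X q, ψ₀ X q = C' X q - C X q := fun _ _ => rfl
  refine ⟨K.toSubmodule.liftQ ψ₀ fun X hX => ?_, ?_⟩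
  · refine LinearMap.mem_ker.2 (LinearMap.ext fun q => ?_)
    rw [hψ₀, hC ⟨X, hX⟩, hC' ⟨X, hX⟩, sub_self]
    rfl
  -- Since both connections act as `P` along `K`, the differential of `C' - C` at `(Y, X)` is the
  -- difference of the two curvatures, and that of `C` is zero by `hcurv`.
  · ext Y X q
    have h := hcurv Y X q
    simp only [curvature_apply, hC] at h
    simp only [d₀_apply, bottHom, hom_apply, LinearMap.sub_apply, LinearMap.comp_apply,
      Submodule.mkQ_apply, bott_mk, curvatureForm_mk, curvature_apply, Submodule.liftQ_apply,
      hψ₀, hC', P.map_sub_right]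
    rw [← sub_eq_zero]
    refine Eq.trans ?_ (neg_eq_zero.2 h)
    abel

end LinearConnection

/-! ## The extension defined by a parallel frame -/

noncomputable section Extension

section Splitting

variable {E M F : Type*} [NormedAddCommGroup E] [NormedSpace ℝ E] [FiniteDimensional ℝ E]
  [TopologicalSpace M] [ChartedSpace E M] [IsManifold 𝓘(ℝ, E) ∞ M]
  [NormedAddCommGroup F] [NormedSpace ℝ F]
  {A : M → Type*} [TopologicalSpace (TotalSpace F A)] [∀ x, AddCommGroup (A x)]
  [∀ x, Module ℝ (A x)] [∀ x, TopologicalSpace (A x)] [FiberBundle F A] [VectorBundle ℝ F A]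

namespace LocallyFiniteFrame

variable {ι ι₀ : Type*} {N : ∀ x, Submodule ℝ (A x)}

/-- The connection on `A` which is the sum of the Grassmann connection of a frame of `A` modulo `N`
and of a connection along `N`. -/
def connection (e : LocallyFiniteFrame ι E F N)
    (e₀ : LocallyFiniteFrame ι₀ E F (fun x => (⊥ : Submodule ℝ (A x)))) :
    LinearConnection (SmoothFn E M) (SmoothVF E M) (SmoothSec E F A) where
  toFun X a := e.deriv X a + (e₀.deriv X (a - e.proj a) - e.proj (e₀.deriv X (a - e.proj a)))
  add_left X Y a := by
    simp only [deriv_add_left, map_add]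
    abel
  smul_left f X a := by
    simp only [deriv_smul_left, map_smul, smul_add, smul_sub]
  add_right X a b := by
    rw [map_add, add_sub_add_comm]
    simp only [deriv_add_right, map_add]
    abel
  leibniz X f a := by
    -- The first summand yields the Leibniz term `X(f) • e.proj a`. The second yields `X(f) • b`,
    -- since `e₀.proj` is the identity and `e.proj b = 0`. They add up to `X(f) • a`.
    obtain ⟨b, hb⟩ : ∃ b, b = a - e.proj a := ⟨_, rfl⟩
    have h0 : e.proj b = 0 := by rw [hb, map_sub, proj_proj, sub_self]
    have h1 : ⁅X, f⁆ • a = ⁅X, f⁆ • e.proj a + ⁅X, f⁆ • b := by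
      rw [← smul_add, hb, add_sub_cancel]
    rw [map_smul, ← smul_sub, ← hb, h1]
    simp only [deriv_smul_right, map_add, map_smul, proj_eq_self, h0, smul_zero, smul_add,
      smul_sub]
    abel

/-- The summand involving `e₀` ends with the projector `1 - e.proj` onto sections of `N`, so modulo
`N` only the Grassmann operator of `e` remains. -/
theorem connection_sub_deriv_mem (e : LocallyFiniteFrame ι E F N)
    (e₀ : LocallyFiniteFrame ι₀ E F (fun x => (⊥ : Submodule ℝ (A x)))) (X : SmoothVF E M)
    (a : SmoothSec E F A) (x : M) : (e.connection e₀ X a - e.deriv X a) x ∈ N x := by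
  change (e.deriv X a + (e₀.deriv X (a - e.proj a) - e.proj (e₀.deriv X (a - e.proj a)))
    - e.deriv X a) x ∈ N x
  rw [add_sub_cancel_left]
  exact e.sub_proj_mem _ x

/-- If the functions `λᵢ(sⱼ)` are annihilated by `Y`, then the functionals of the frame intertwine
the Grassmann operator with the derivative along `Y`. -/
theorem coeff_deriv (e : LocallyFiniteFrame ι E F N) {Y : SmoothVF E M}
    (hY : ∀ i j, ⁅Y, e.coeff i (e.sec j)⁆ = 0) (i : ι) (a : SmoothSec E F A) :
    e.coeff i (e.deriv Y a) = ⁅Y, e.coeff i a⁆ := by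
  ext x
  obtain ⟨t, ht⟩ := e.exists_finset x
  have h1 : e.coeff i (e.deriv Y a) x =
      e.coeff i (∑ j ∈ t, ⁅Y, e.coeff j a⁆ • e.sec j) x :=
    e.coeff_congr i (by rw [e.deriv_apply Y a ht.self_of_nhds, sub_self]; exact (N x).zero_mem)
  -- The derivative at `x` depends only on `λᵢ(a)` near `x`, where `a` equals a finite combination
  -- of the `sⱼ` modulo `N`. The product rule then leaves only `∑ Y(λⱼ(a)) λᵢ(sⱼ)`.
  have h2 : ⁅Y, e.coeff i a⁆ x = ⁅Y, e.coeff i (∑ j ∈ t, e.coeff j a • e.sec j)⁆ x := by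
    refine Y.lie_fn_congr ?_
    filter_upwards [ht] with y hy
    refine e.coeff_congr i ?_
    rw [← e.proj_apply a hy]
    exact e.sub_proj_mem a y
  rw [h1, h2, map_sum, map_sum]
  have h3 : ∀ f : ι → SmoothFn E M, ⁅Y, ∑ j ∈ t, f j⁆ = ∑ j ∈ t, ⁅Y, f j⁆ := fun f =>
    map_sum (AddMonoidHom.mk' (fun g : SmoothFn E M => ⁅Y, g⁆) (lie_add Y)) f t
  rw [h3]
  congr 1
  refine Finset.sum_congr rfl fun j _ => ?_
  rw [map_smul, map_smul, smul_eq_mul, smul_eq_mul, LieRinehartRing.leibniz_mul_right, hY,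
    smul_zero, zero_add]

end LocallyFiniteFrame

end Splitting

namespace FlatPartialConnection

variable {E M F : Type*} [NormedAddCommGroup E] [NormedSpace ℝ E] [FiniteDimensional ℝ E]
  [TopologicalSpace M] [ChartedSpace E M] [IsManifold 𝓘(ℝ, E) ∞ M]
  [NormedAddCommGroup F] [NormedSpace ℝ F]
  {A : M → Type*} [TopologicalSpace (TotalSpace F A)] [∀ x, AddCommGroup (A x)]
  [∀ x, Module ℝ (A x)] [∀ x, TopologicalSpace (A x)] [FiberBundle F A] [VectorBundle ℝ F A]
  (P : FlatPartialConnection E F A)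

theorem mk_connection {P : FlatPartialConnection E F A} {ι ι₀ : Type*}
    (e : LocallyFiniteFrame ι E F P.J.fiber)
    (e₀ : LocallyFiniteFrame ι₀ E F (fun x => (⊥ : Submodule ℝ (A x)))) (X : SmoothVF E M)
    (a : SmoothSec E F A) :
    (Submodule.Quotient.mk (e.connection e₀ X a) : P.J.QuotSec) =
      Submodule.Quotient.mk (e.deriv X a) :=
  (Submodule.Quotient.eq P.J.sections).2 (e.connection_sub_deriv_mem e₀ X a)

variable [T2Space M] [SigmaCompactSpace M]

/-- Locality by a cutoff `g` with `g x = 0` and `g = 1` off a neighbourhood where `q` vanishes: then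
`q = g • q`, and both Leibniz terms vanish at `x`. -/
theorem conn_eq_zero_of_eventually_zero (Y : P.leafFields) {q : P.J.QuotSec} {x : M}
    (h : ∀ᶠ y in 𝓝 x, P.J.evalQuot y q = 0) : P.J.evalQuot x (P.conn Y q) = 0 := by
  obtain ⟨U, hU, hUo, hxU⟩ := eventually_nhds_iff.1 h
  obtain ⟨g, hg0, hg1, -⟩ := exists_contMDiffMap_zero_one_of_isClosed (n := (⊤ : ℕ∞)) 𝓘(ℝ, E)
    (isClosed_singleton (x := x)) hUo.isClosed_compl
    (Set.disjoint_singleton_left.2 fun hx => hx hxU)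
  let g' : SmoothFn E M := g
  have hgx : g' x = 0 := hg0 rfl
  have hq : q = g' • q := by
    refine P.J.evalQuot_injective _ _ fun y => ?_
    rw [map_smulₛₗ]
    change _ = g' y • _
    by_cases hy : y ∈ U
    · rw [hU y hy, smul_zero]
    · have : g' y = 1 := hg1 hy
      rw [this, one_smul]
  rw [hq, P.conn.leibniz, map_add, map_smulₛₗ, map_smulₛₗ, h.self_of_nhds, smul_zero, add_zero]
  change g' x • _ = _
  rw [hgx, zero_smul]

theorem conn_congr (Y : P.leafFields) {q r : P.J.QuotSec} {x : M}
    (h : ∀ᶠ y in 𝓝 x, P.J.evalQuot y q = P.J.evalQuot y r) :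
    P.J.evalQuot x (P.conn Y q) = P.J.evalQuot x (P.conn Y r) := by
  have h1 : P.J.evalQuot x (P.conn Y (q - r)) = 0 :=
    P.conn_eq_zero_of_eventually_zero Y (h.mono fun y hy => by rw [map_sub, hy, sub_self])
  rwa [P.conn.map_sub_right, map_sub, sub_eq_zero] at h1

variable {P} {ι ι₀ : Type*}

/-- By locality the sum is finite near each point, and since the frame is parallel only the
coefficients are differentiated. The coefficients are arbitrary because the curvature computation
needs the family `X(λᵢ(a))`, besides the coefficients of a section. -/
theorem conn_mk_sum (e : LocallyFiniteFrame ι E F P.J.fiber)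
    (he : ∀ X i, P.conn X (Submodule.Quotient.mk (e.sec i)) = 0) (Y : P.leafFields)
    (c : e.coeffModule) :
    P.conn Y (Submodule.Quotient.mk (e.sum c)) =
      Submodule.Quotient.mk (e.sum ⟨_, e.lie_coeffs_mem (Y : SmoothVF E M) c⟩) := by
  refine P.J.evalQuot_injective _ _ fun x => ?_
  obtain ⟨t, ht⟩ := e.exists_finset x
  have h1 : ∀ᶠ y in 𝓝 x, P.J.evalQuot y (Submodule.Quotient.mk (e.sum c)) =
      P.J.evalQuot y (Submodule.Quotient.mk (∑ i ∈ t, c.1 i • e.sec i)) := by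
    filter_upwards [ht] with y hy
    rw [P.J.evalQuot_mk, P.J.evalQuot_mk, e.sum_apply c hy]
  rw [P.conn_congr Y h1, P.J.evalQuot_mk, e.sum_apply _ ht.self_of_nhds, ← P.J.evalQuot_mk]
  congr 1
  have h2 : ∀ s : ι → SmoothSec E F A, (Submodule.Quotient.mk (∑ i ∈ t, s i) : P.J.QuotSec) =
      ∑ i ∈ t, Submodule.Quotient.mk (s i) := fun s => map_sum P.J.sections.mkQ s t
  have h3 : ∀ q : ι → P.J.QuotSec, P.conn Y (∑ i ∈ t, q i) = ∑ i ∈ t, P.conn Y (q i) := fun q =>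
    map_sum (AddMonoidHom.mk' (P.conn Y) (P.conn.add_right Y)) q t
  rw [h2, h2, h3]
  refine Finset.sum_congr rfl fun i _ => ?_
  rw [Submodule.Quotient.mk_smul, Submodule.Quotient.mk_smul, P.conn.leibniz, he, smul_zero,
    zero_add]
  rfl

theorem conn_mk (e : LocallyFiniteFrame ι E F P.J.fiber)
    (he : ∀ X i, P.conn X (Submodule.Quotient.mk (e.sec i)) = 0) (Y : P.leafFields)
    (a : SmoothSec E F A) :
    P.conn Y (Submodule.Quotient.mk a) = Submodule.Quotient.mk (e.deriv (Y : SmoothVF E M) a) := by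
  have h : (Submodule.Quotient.mk a : P.J.QuotSec) = Submodule.Quotient.mk (e.proj a) :=
    (Submodule.Quotient.eq P.J.sections).2 (e.sub_proj_mem a)
  rw [h]
  exact conn_mk_sum e he Y (e.coeffs a)

/-- Sections of `J` have zero coefficients, so modulo `J` the connection annihilates them; along
`F_M` it agrees with `∇` because the frame is parallel. -/
theorem isExtension_connection (e : LocallyFiniteFrame ι E F P.J.fiber)
    (e₀ : LocallyFiniteFrame ι₀ E F (fun x => (⊥ : Submodule ℝ (A x))))
    (he : ∀ X i, P.conn X (Submodule.Quotient.mk (e.sec i)) = 0) :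
    P.IsExtension (e.connection e₀) where
  preserves X k hk := by
    have h := mk_connection e e₀ X k
    rw [e.deriv_eq_zero X hk, Submodule.Quotient.mk_zero] at h
    exact (Submodule.Quotient.mk_eq_zero _).1 h
  restricts Y q := by
    induction q using Submodule.Quotient.induction_on with
    | _ a => rw [LinearConnection.quotient_mk, mk_connection, conn_mk e he]

/-- Modulo `J`, `D_Y D_X a = ∑ Y(X(λᵢ(a))) sᵢ` because the `sᵢ` are parallel, and `D_X D_Y a = ∑
X(Y(λᵢ(a))) sᵢ` because `λᵢ(D_Y a) = Y(λᵢ(a))`. Their difference is `∑ [Y, X](λᵢ(a)) sᵢ`, which is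
`D_[Y,X] a`. -/
theorem curvature_connection_eq_zero (e : LocallyFiniteFrame ι E F P.J.fiber)
    (e₀ : LocallyFiniteFrame ι₀ E F (fun x => (⊥ : Submodule ℝ (A x))))
    (he : ∀ X i, P.conn X (Submodule.Quotient.mk (e.sec i)) = 0)
    (hY : ∀ Y : P.leafFields, ∀ i j, ⁅(Y : SmoothVF E M), e.coeff i (e.sec j)⁆ = 0)
    (Y : P.leafFields) (X : SmoothVF E M) (q : P.J.QuotSec) :
    ((e.connection e₀).quotient P.J.sections (isExtension_connection e e₀ he).preserves).curvature
      (Y : SmoothVF E M) X q = 0 := by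
  induction q using Submodule.Quotient.induction_on with
  | _ a =>
    set D := (e.connection e₀).quotient P.J.sections (isExtension_connection e e₀ he).preserves
    have hD : ∀ (Z : SmoothVF E M) (b : SmoothSec E F A),
        D Z (Submodule.Quotient.mk b) = Submodule.Quotient.mk (e.deriv Z b) :=
      fun Z b => mk_connection e e₀ Z b
    -- The frame is redundant, so differentiating `∑ cᵢ sᵢ` coefficientwise is not legitimate for a
    -- general vector field; it is for `Y`, where `D` is `∇` and the `sᵢ` are parallel.
    have h1 : D (Y : SmoothVF E M) (Submodule.Quotient.mk (e.deriv X a)) =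
        Submodule.Quotient.mk (e.sum ⟨_, e.lie_coeffs_mem (Y : SmoothVF E M)
          ⟨_, e.lie_coeffs_mem X (e.coeffs a)⟩⟩) :=
      ((isExtension_connection e e₀ he).restricts Y _).trans (conn_mk_sum e he Y _)
    have h2 : e.sum ⟨_, e.lie_coeffs_mem (Y : SmoothVF E M)
        ⟨_, e.lie_coeffs_mem X (e.coeffs a)⟩⟩ =
        e.deriv ⁅(Y : SmoothVF E M), X⁆ a + e.deriv X (e.deriv (Y : SmoothVF E M) a) := by
      change e.sum _ = e.sum _ + e.sum _
      rw [← map_add]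
      congr 1
      ext1
      funext i
      change ⁅(Y : SmoothVF E M), ⁅X, e.coeff i a⁆⁆ = ⁅⁅(Y : SmoothVF E M), X⁆, e.coeff i a⁆ +
        ⁅X, e.coeff i (e.deriv (Y : SmoothVF E M) a)⁆
      rw [e.coeff_deriv (hY Y), leibniz_lie]
    rw [LinearConnection.curvature_apply, hD X a, h1, h2, hD _ a, hD, hD _ a,
      Submodule.Quotient.mk_add, add_sub_cancel_right, sub_self]

theorem atiyahClass_eq_zero (e : LocallyFiniteFrame ι E F P.J.fiber)
    (e₀ : LocallyFiniteFrame ι₀ E F (fun x => (⊥ : Submodule ℝ (A x))))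
    (he : ∀ X i, P.conn X (Submodule.Quotient.mk (e.sec i)) = 0)
    (hY : ∀ Y : P.leafFields, ∀ i j, ⁅(Y : SmoothVF E M), e.coeff i (e.sec j)⁆ = 0)
    {D : LinearConnection (SmoothFn E M) (SmoothVF E M) (SmoothSec E F A)}
    (hD : P.IsExtension D) : atiyahClass hD = 0 := by
  obtain ⟨ψ, hψ⟩ := LinearConnection.exists_d₀_eq_curvatureForm P.leafFields P.conn _ _
    (isExtension_connection e e₀ he).restricts hD.restricts
    (curvature_connection_eq_zero e e₀ he hY) hD.isFlat
  exact LinearConnection.mk_eq_zero_of_d₀_eq (LinearConnection.bottHom P.conn)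
    ⟨atiyahForm hD, d₁_atiyahForm hD⟩ (v := ψ) hψ

end FlatPartialConnection

end Extension

/-! ### Sections through prescribed vectors -/

theorem exists_smoothSec_apply_eq
    {E M F : Type*} [NormedAddCommGroup E] [NormedSpace ℝ E] [FiniteDimensional ℝ E]
    [TopologicalSpace M] [T2Space M] [SigmaCompactSpace M] [ChartedSpace E M]
    [IsManifold 𝓘(ℝ, E) ∞ M]
    [NormedAddCommGroup F] [NormedSpace ℝ F] [FiniteDimensional ℝ F]
    {A : M → Type*} [TopologicalSpace (TotalSpace F A)] [∀ x, AddCommGroup (A x)]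
    [∀ x, Module ℝ (A x)] [∀ x, TopologicalSpace (A x)] [FiberBundle F A] [VectorBundle ℝ F A]
    [ContMDiffVectorBundle ∞ F A 𝓘(ℝ, E)] (x : M) (a : A x) :
    ∃ s : SmoothSec E F A, s x = a := by
  let τ := trivializationAt F A x
  have hx : x ∈ τ.baseSet := FiberBundle.mem_baseSet_trivializationAt' x
  obtain ⟨s, hs⟩ := exists_contMDiffSection_forall_mem_convex_of_local (n := (⊤ : ℕ∞)) 𝓘(ℝ, E) A
    -- This convex set is `{a}` over `x` and the whole fibre elsewhere. Local solutions are constant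
    -- sections in a trivialization near `x` and the zero section away from `x`.
    (fun y => {v : A y | ∀ h : y = x, h ▸ v = a})
    (fun y => by
      by_cases h : y = x
      · subst h
        simp
      · simpa [h] using convex_univ)
    (fun y => by
      by_cases h : y = x
      · subst h
        refine ⟨τ.baseSet, τ.open_baseSet.mem_nhds hx, fun z => τ.symm z (τ ⟨y, a⟩).2, ?_, ?_⟩
        · refine (τ.contMDiffOn_section_baseSet_iff).2 ?_
          refine (contMDiffOn_const (c := (τ ⟨y, a⟩).2)).congr fun z hz => ?_
          rw [τ.apply_mk_symm hz]
        · rintro z - rfl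
          exact τ.symm_apply_apply_mk hx a
      · exact ⟨{x}ᶜ, isOpen_compl_singleton.mem_nhds h, 0, contMDiff_zeroSection ℝ A |>.contMDiffOn,
          fun z hz hzx => absurd hzx hz⟩)
  exact ⟨s, hs x rfl⟩

/-! ### Parallel sections and the quotient map -/

namespace QuotientLieAlgebroid

variable {E M F : Type*} [NormedAddCommGroup E] [NormedSpace ℝ E] [FiniteDimensional ℝ E]
  [TopologicalSpace M] [ChartedSpace E M] [IsManifold 𝓘(ℝ, E) ∞ M]
  [NormedAddCommGroup F] [NormedSpace ℝ F]
  {A : M → Type*} [TopologicalSpace (TotalSpace F A)] [∀ x, AddCommGroup (A x)]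
  [∀ x, Module ℝ (A x)] [∀ x, TopologicalSpace (A x)] [FiberBundle F A] [VectorBundle ℝ F A]
  {𝒜 : LieAlgebroid E F A} {I : InfinitesimalIdealSystem 𝒜}
  {E' M' F' : Type*} [NormedAddCommGroup E'] [NormedSpace ℝ E'] [FiniteDimensional ℝ E']
  [TopologicalSpace M'] [ChartedSpace E' M'] [IsManifold 𝓘(ℝ, E') ∞ M']
  [NormedAddCommGroup F'] [NormedSpace ℝ F']
  {A' : M' → Type*} [TopologicalSpace (TotalSpace F' A')] [∀ x, AddCommGroup (A' x)]
  [∀ x, Module ℝ (A' x)] [∀ x, TopologicalSpace (A' x)] [FiberBundle F' A']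
  [VectorBundle ℝ F' A'] {𝒜' : LieAlgebroid E' F' A'} (Q : QuotientLieAlgebroid I 𝒜')

-- The equality `π(a) = π(a)` already forces some parallel section to pass through the class of `a`.
include Q in
theorem exists_parallel (x : M) (a : A x) :
    ∃ s : SmoothSec E F A, (∀ X, I.conn X (Submodule.Quotient.mk s) = 0) ∧
      (Submodule.Quotient.mk (s x) : A x ⧸ I.J.fiber x) = Submodule.Quotient.mk a := by
  obtain ⟨-, q, hq, hqx, -⟩ := (Q.map_eq_iff x x a a).1 rfl
  induction q using Submodule.Quotient.induction_on with
  | _ s => exact ⟨s, hq, hqx⟩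

/-- If `π(a) = π(0)`, some section has both the class of `a` and zero as its value at `x`, so that
class is zero. Conversely, if the class of `a` is zero, the relation of `a` with itself is also its
relation with `0`. -/
theorem ker_map (x : M) : LinearMap.ker (Q.map x) = I.J.fiber x := by
  ext a
  rw [LinearMap.mem_ker]
  have h := Q.map_eq_iff x x a 0
  constructor
  · intro ha
    obtain ⟨-, q, -, h1, h2⟩ := h.1 (by rw [ha, map_zero])
    exact (Submodule.Quotient.mk_eq_zero _).1 (h1.symm.trans h2)
  · intro ha
    have h1 : (Submodule.Quotient.mk a : A x ⧸ I.J.fiber x) = Submodule.Quotient.mk 0 :=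
      (Submodule.Quotient.mk_eq_zero _).2 ha
    have h2 := (Q.map_eq_iff x x a a).1 rfl
    have h3 := h.2 (h1 ▸ h2)
    have h4 := eq_of_heq (TotalSpace.mk.inj h3).2
    rw [h4, map_zero]

/-- Parallel sections descend to the quotient. -/
theorem map_eq_of_parallel {s : SmoothSec E F A}
    (hs : ∀ X, I.conn X (Submodule.Quotient.mk s) = 0) {x y : M} (hxy : Q.base x = Q.base y) :
    (⟨Q.base x, Q.map x (s x)⟩ : TotalSpace F' A') = ⟨Q.base y, Q.map y (s y)⟩ :=
  (Q.map_eq_iff x y _ _).2 ⟨(Q.base_eq_iff x y).1 hxy, Submodule.Quotient.mk s, hs, rfl, rfl⟩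

end QuotientLieAlgebroid

/-! ### Vanishing of the Atiyah class -/

theorem mainTheorem7
    {E M F : Type*} [NormedAddCommGroup E] [NormedSpace ℝ E] [FiniteDimensional ℝ E]
    [TopologicalSpace M] [T2Space M] [SigmaCompactSpace M] [ChartedSpace E M]
    [IsManifold 𝓘(ℝ, E) ∞ M]
    [NormedAddCommGroup F] [NormedSpace ℝ F] [FiniteDimensional ℝ F]
    {A : M → Type*} [TopologicalSpace (TotalSpace F A)] [∀ x, AddCommGroup (A x)]
    [∀ x, Module ℝ (A x)] [∀ x, TopologicalSpace (A x)] [FiberBundle F A] [VectorBundle ℝ F A]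
    [ContMDiffVectorBundle ∞ F A 𝓘(ℝ, E)]
    (𝒜 : LieAlgebroid E F A) (I : InfinitesimalIdealSystem 𝒜)
    {E' M' F' : Type*} [NormedAddCommGroup E'] [NormedSpace ℝ E'] [FiniteDimensional ℝ E']
    [TopologicalSpace M'] [T2Space M'] [SigmaCompactSpace M'] [ChartedSpace E' M']
    [IsManifold 𝓘(ℝ, E') ∞ M']
    [NormedAddCommGroup F'] [NormedSpace ℝ F'] [FiniteDimensional ℝ F']
    {A' : M' → Type*} [TopologicalSpace (TotalSpace F' A')] [∀ x, AddCommGroup (A' x)]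
    [∀ x, Module ℝ (A' x)] [∀ x, TopologicalSpace (A' x)] [FiberBundle F' A']
    [VectorBundle ℝ F' A'] [ContMDiffVectorBundle ∞ F' A' 𝓘(ℝ, E')]
    (𝒜' : LieAlgebroid E' F' A') (hquot : Nonempty (QuotientLieAlgebroid I 𝒜')) :
    (∃ D, I.IsExtension D) ∧
      ∀ D (hD : I.IsExtension D), FlatPartialConnection.atiyahClass hD = 0 := by
  obtain ⟨Q⟩ := hquot
  -- The identity of `A` over the identity of `M`, with all sections allowed, gives a frame modulo
  -- zero; it serves to differentiate along `J`.
  obtain ⟨e₀, -, -⟩ := exists_locallyFiniteFrame (E := E) (F := F) (E' := E) (F' := F)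
    (p := fun x : M => x) contMDiff_id IsOpenMap.id
    Function.surjective_id (fun x => (LinearMap.id : A x →ₗ[ℝ] A x)) contMDiff_id
    (fun _ => Function.surjective_id) Set.univ
    (fun x a => (exists_smoothSec_apply_eq x a).imp fun s hs => ⟨trivial, hs⟩)
    (by rintro s - x _ rfl; rfl)
  obtain ⟨e, he, hinv⟩ := exists_locallyFiniteFrame Q.contMDiff_base Q.base_submersion.isOpenMap
    Q.base_surjective Q.map Q.contMDiff_map Q.map_surjective
    {s | ∀ X, I.conn X (Submodule.Quotient.mk s) = 0}
    (fun x a => (Q.exists_parallel x a).imp fun s hs => ⟨hs.1, by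
      have h := (Submodule.Quotient.eq _).1 hs.2
      rwa [← Q.ker_map, LinearMap.mem_ker, map_sub, sub_eq_zero] at h⟩)
    (fun s hs x y => Q.map_eq_of_parallel hs)
  have hker : (fun x => LinearMap.ker (Q.map x)) = I.J.fiber := funext Q.ker_map
  have hbot : (fun x => LinearMap.ker (LinearMap.id : A x →ₗ[ℝ] A x)) = fun x => ⊥ :=
    funext fun x => LinearMap.ker_id
  -- The functions `λᵢ(sⱼ)` are constant on the fibres of the submersion, and `F_M` is its vertical
  -- bundle.
  have hY : ∀ Y : I.leafFields, ∀ i j, ⁅(Y : SmoothVF E M), e.coeff i (e.sec j)⁆ = 0 :=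
    fun Y i j => by
      ext x
      exact Q.base_submersion.mvfderiv_eq_zero (e.coeff i (e.sec j)).contMDiff
        (hinv i _ (he j)) ((Q.mem_FM_iff x _).1 (Y.2 x))
  -- The frame types depend on the families of kernels, which equal `J` and zero only
  -- propositionally; generalizing them permits the substitution.
  generalize (fun x => LinearMap.ker (Q.map x)) = N at e he hinv hY hker
  generalize (fun x => LinearMap.ker (LinearMap.id : A x →ₗ[ℝ] A x)) = N₀ at e₀ hbot
  subst hker hbot
  exact ⟨⟨_, FlatPartialConnection.isExtension_connection e e₀ fun X i => he i X⟩, fun D hD =>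
    FlatPartialConnection.atiyahClass_eq_zero e e₀ (fun X i => he i X) hY hD⟩
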